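/- Let $K$ be a field of characteristic $0$. For a partition $\lambda$, let $S_\lambda$ be the Schur function (over $K$, in infinitely many variables), and for $k,\ell\ge 0$ let $$HS_\lambda(x_1,\ldots,x_k;y_1,\ldots,y_\ell)=\sum_T x^T$$ be the hook Schur function. Here $T$ runs over the $(k,\ell)$-semistandard tableaux of shape $\lambda$, that is, the fillings of $\lambda$ by the symbols $1<2<\cdots<k<1'<\cdots<\ell'$ whose rows and columns are non-decreasing, in which an unprimed symbol may repeat in rows but not in columns and a primed symbol may repeat in columns but not in rows. The monomial $x^T$ has degree in $x_j$ equal to the number of entries $j$ of $T$, and degree in $y_j$ equal to the number of entries $j'$ of $T$. A symmetric function $\sum_\lambda m_\lambda S_\lambda$ (a finite sum with $m_\lambda\in K$) is called doubly symmetric if $$\sum_\lambda m_\lambda S_\lambda(x_1,\ldots,x_k,y_1,\ldots,y_\ell)=\sum_\lambda m_\lambda HS_\lambda(x_1,\ldots,x_k;y_1,\ldots,y_\ell)$$ for all $k,\ell\ge 0$. Let $\mathcal{D}$ be the $K$-vector space of doubly symmetric functions, and let $\mathcal{D}_n$ be the subspace of those which are homogeneous of degree $n$ (including $0$). Then for every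 $n\ge 0$ the space $\mathcal{D}_n$ is finite-dimensional, and its dimension equals the number of partitions of $n$ into odd parts. Equivalently, $\dim_K\mathcal{D}_n$ is the coefficient of $x^n$ in $$\prod_{k\ge 0}(1-x^{2k+1})^{-1}=\prod_{k\ge 1}(1+x^k),$$ where both infinite products converge as formal power series and the two are equal. -/

import Mathlib

open scoped PowerSeries PowerSeries.WithPiTopology

noncomputable section

namespace DoublySymmetric

/-- The content of a semistandard tableau `T`: the exponent vector of the monomial `x ^ T`, in which
`x_i` has exponent the number of entries of `T` equal to `i`. (The variables are
`x_0, x_1, x_2, …` and the entries of a tableau are natural numbers.) -/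
def content {μ : YoungDiagram} (T : SemistandardYoungTableau μ) : ℕ →₀ ℕ :=
  ∑ c ∈ μ.cells, Finsupp.single (T c.1 c.2) 1

/-- For each exponent vector `d` there are only finitely many semistandard tableaux of shape `μ` and
content `d`, so that the coefficients of the Schur function are honest numbers. -/
theorem finite_content (μ : YoungDiagram) (d : ℕ →₀ ℕ) :
    Finite {T : SemistandardYoungTableau μ // content T = d} := by
  classical
  let F : {T : SemistandardYoungTableau μ // content T = d} → (μ.cells → d.support) :=
    fun T c => ⟨T.1 c.1.1 c.1.2, by
      have h : content T.1 (T.1 c.1.1 c.1.2) = d (T.1 c.1.1 c.1.2) := by rw [T.2]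
      rw [Finsupp.mem_support_iff, ← h, content, Finsupp.finsetSum_apply]
      intro h0
      have := (Finset.sum_eq_zero_iff.mp h0) c.1 c.2
      simp at this⟩
  refine Finite.of_injective F fun T T' h => Subtype.ext (SemistandardYoungTableau.ext fun i j => ?_)
  by_cases hc : (i, j) ∈ μ
  · exact congrArg Subtype.val (congrFun h ⟨(i, j), hc⟩)
  · rw [T.1.zeros hc, T'.1.zeros hc]

/-- The Schur function `S_μ = ∑_T x ^ T`, summed over all semistandard tableaux `T` of shape `μ`, as
a formal power series in the infinitely many variables `x_0, x_1, x_2, …`. -/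
def schurFunction (K : Type*) [Field K] (μ : YoungDiagram) : MvPowerSeries ℕ K :=
  fun d => (Nat.card {T : SemistandardYoungTableau μ // content T = d} : K)

/-- The alphabet `1 < 2 < ⋯ < k < 1' < 2' < ⋯ < ℓ'`: the lexicographic sum of the `k` ordinary symbols
and the `ℓ` primed symbols. -/
abbrev Alphabet (k l : ℕ) : Type := Fin k ⊕ₗ Fin l

/-- The symbol `s` is one of the primed symbols. -/
def IsPrimed {k l : ℕ} (s : Alphabet k l) : Prop := (ofLex s).isRight = true

/-- `T` is a `(k, ℓ)`-semistandard tableau of shape `μ`: the entries are non-decreasing in each row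
and column, unprimed symbols may repeat in rows but not in columns, and primed symbols may repeat in
columns but not in rows. (The cell `(i, j)` lies in row `i` and column `j`.) -/
structure IsHookTableau {k l : ℕ} {μ : YoungDiagram} (T : μ.cells → Alphabet k l) : Prop where
  row_weak : ∀ a b : μ.cells, a.1.1 = b.1.1 → a.1.2 < b.1.2 → T a ≤ T b
  col_weak : ∀ a b : μ.cells, a.1.2 = b.1.2 → a.1.1 < b.1.1 → T a ≤ T b
  row_primed : ∀ a b : μ.cells, a.1.1 = b.1.1 → a.1.2 < b.1.2 → T a = T b → ¬ IsPrimed (T a)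
  col_unprimed : ∀ a b : μ.cells, a.1.2 = b.1.2 → a.1.1 < b.1.1 → T a = T b → IsPrimed (T a)

open Classical in
/-- The hook Schur function `HS_μ(x_1, …, x_k; y_1, …, y_ℓ) = ∑_T x ^ T`, summed over all
`(k, ℓ)`-semistandard tableaux `T` of shape `μ`. The variable `x_i` is `X (Sum.inl i)`, and `y_j` is
`X (Sum.inr j)`. -/
def hookSchur (K : Type*) [Field K] (k l : ℕ) (μ : YoungDiagram) :
    MvPolynomial (Fin k ⊕ Fin l) K :=
  ∑ T : μ.cells → Alphabet k l with IsHookTableau T, ∏ c : μ.cells, MvPolynomial.X (ofLex (T c))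

/-- The names of the variables `x_1, …, x_k, y_1, …, y_ℓ`, in this order, as the first `k + ℓ`
variables of a symmetric function. -/
def varEmbedding (k l : ℕ) : Fin k ⊕ Fin l ↪ ℕ :=
  finSumFinEquiv.toEmbedding.trans Fin.valEmbedding

/-- `specialize K k l f = f(x_1, …, x_k, y_1, …, y_ℓ)`: the first `k + ℓ` variables of `f` are
named `x_1, …, x_k, y_1, …, y_ℓ`, and all the others are set equal to `0`. -/
def specialize (K : Type*) [Field K] (k l : ℕ) :
    MvPowerSeries ℕ K →ₐ[K] MvPowerSeries (Fin k ⊕ Fin l) K :=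
  MvPowerSeries.killCompl (varEmbedding k l)

/-- The space `𝒟` of doubly symmetric functions over `K`: the symmetric functions `∑ m_μ S_μ`
(finite sums) with `∑ m_μ S_μ(X, Y) = ∑ m_μ HS_μ(X; Y)` for all finite, possibly empty, sets of
variables `X = {x_1, …, x_k}` and `Y = {y_1, …, y_ℓ}`. -/
def doublySymmetric (K : Type*) [Field K] : Submodule K (MvPowerSeries ℕ K) where
  carrier := {f | ∃ m : YoungDiagram →₀ K,
    f = m.sum (fun μ a => a • schurFunction K μ) ∧
    ∀ k l : ℕ, specialize K k l f =
      ((m.sum (fun μ a => a • hookSchur K k l μ) : MvPolynomial (Fin k ⊕ Fin l) K) :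
        MvPowerSeries (Fin k ⊕ Fin l) K)}
  zero_mem' := ⟨0, by simp, by simp⟩
  add_mem' := by
    rintro f g ⟨m, hm, hm'⟩ ⟨p, hp, hp'⟩
    refine ⟨m + p, ?_, fun k l => ?_⟩
    · rw [Finsupp.sum_add_index' (by simp) (by simp [add_smul]), hm, hp]
    · rw [Finsupp.sum_add_index' (by simp) (by simp [add_smul]), map_add, hm', hp',
        MvPolynomial.coe_add]
  smul_mem' := by
    rintro c f ⟨m, hm, hm'⟩
    refine ⟨c • m, ?_, fun k l => ?_⟩
    · rw [Finsupp.sum_smul_index' (by simp), hm, Finsupp.smul_sum]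
      simp [mul_smul]
    · rw [Finsupp.sum_smul_index' (by simp), map_smul, hm', ← MvPolynomial.coe_smul,
        Finsupp.smul_sum]
      simp [mul_smul]

/-- The power series over `K` that are homogeneous of degree `n` (including `0`). -/
def homogeneousPart (K : Type*) [Field K] (n : ℕ) : Submodule K (MvPowerSeries ℕ K) where
  carrier := {f | f.IsHomogeneous n}
  zero_mem' := fun h => absurd (map_zero _) h
  add_mem' := fun hf hg => hf.add hg
  smul_mem' := fun c f hf d hd => hf (d := d) fun h0 => hd (by
    rw [← smul_zero c, ← h0]
    exact map_smul (MvPowerSeries.coeff d) c f)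

/-- The space of doubly symmetric functions of degree `n`. -/
def doublySymmetricOfDegree (K : Type*) [Field K] (n : ℕ) : Submodule K (MvPowerSeries ℕ K) :=
  doublySymmetric K ⊓ homogeneousPart K n

end DoublySymmetric

end

/-!
Write `h_r^⊥` and `e_r^⊥` for the operators on formal sums `∑ m_μ S_μ` that remove horizontal,
respectively vertical, strips of size `r` from Young diagrams. Removing the largest symbol from a
semistandard tableau removes a horizontal strip from its shape; for a hook tableau this is a
vertical strip if the symbol is primed. So the coefficients of `∑ m_μ S_μ(X, Y)` and of
`∑ m_μ HS_μ(X; Y)` are the values at the empty diagram of words in these operators, applied to `m`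
(`sum_ncard_signedTableaux_mul`). Words in the `h_r^⊥` separate the functions on Young diagrams
(`eq_zero_of_prod_hOp_apply_bot`), whence `∑ m_μ S_μ` is doubly symmetric if and only if
`h_r^⊥ m = e_r^⊥ m` for all `r` (`specialize_eq_hookSchur_iff`).

The operators `h_r^⊥` commute (`hOp_mul_comm`, from a reflection that interchanges the sizes of two
successive strips) and satisfy `∑ (-1)^i e_i^⊥ h_{n-i}^⊥ = 0` for `n ≥ 1` (`sum_eOp_mul_hOp`, from
a sign-reversing involution). So they generate a commutative algebra that contains the `e_r^⊥`, and
the power sum operators `p_n^⊥`, given by `P = H' / H` for `H(t) = ∑ h_r^⊥ t^r`. As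
`E(-t) H(t) = 1`, the condition `H = E` says that `H(t) H(-t) = 1`, hence that `P(t)` is even,
hence that `p_2^⊥, p_4^⊥, …` vanish; this holds modulo the annihilator of `m` as well
(`forall_coeff_sub_mem_iff`, `hOp_eq_eOp_iff`).

Finally the values at the empty diagram of `p_λ^⊥ m`, for the partitions `λ` of `n`, are
coordinates on the sums `∑ m_μ S_μ` of degree `n`: they separate these, and there are as many of
them as Young diagrams with `n` cells (`exists_powerSumCoord_eq`). In these coordinates, the doubly
symmetric functions are those that vanish at every `λ` with an even part
(`oddCoord_bijective`), so their space has the partitions of `n` into odd parts as the index set of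
a basis.
-/

noncomputable section

namespace DoublySymmetric

/-! ### The generating functions of partitions into odd and into distinct parts -/

section GeneratingFunctions

open PowerSeries PowerSeries.WithPiTopology

theorem hasProd_inv_one_sub_X_pow_odd :
    HasProd (fun k : ℕ => ((1 - X ^ (2 * k + 1) : ℚ⟦X⟧))⁻¹)
      (PowerSeries.mk fun n => ((Nat.Partition.odds n).card : ℚ)) := by
  have h := Nat.Partition.hasProd_powerSeriesMk_card_restricted ℚ (¬ Even ·)
  have hinj : Function.Injective (fun k : ℕ => 2 * k) := fun a b h => by simpa using h
  rw [← hinj.hasProd_iff] at h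
  · convert! h using 2 with k
    have h1 : ¬ Even (2 * k + 1) := by simp
    simp only [Function.comp_apply, h1, not_false_eq_true, if_true, pow_mul]
    rw [eq_comm, PowerSeries.eq_inv_iff_mul_eq_one (by simp),
      tsum_pow_mul_one_sub_of_constantCoeff_eq_zero (by simp)]
  · intro i hi
    have : Even (i + 1) := by
      rw [Nat.even_add_one, Nat.not_even_iff_odd]
      by_contra hodd
      rw [Nat.not_odd_iff_even] at hodd
      obtain ⟨k, rfl⟩ := hodd
      exact hi ⟨k, by simp; ring⟩
    simp [this]

theorem hasProd_one_add_X_pow :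
    HasProd (fun k : ℕ => (1 + X ^ (k + 1) : ℚ⟦X⟧))
      (PowerSeries.mk fun n => ((Nat.Partition.distincts n).card : ℚ)) := by
  have h := Nat.Partition.hasProd_powerSeriesMk_card_countRestricted ℚ (m := 2) (by norm_num)
  simpa [Nat.Partition.countRestricted_two, Finset.sum_range_succ] using h

end GeneratingFunctions

/-! ### Young diagrams, their row lengths, and strips -/

theorem rowLen_injective : Function.Injective YoungDiagram.rowLen := fun μ ν h => by
  ext ⟨i, j⟩
  rw [YoungDiagram.mem_cells, YoungDiagram.mem_cells, YoungDiagram.mem_iff_lt_rowLen,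
    YoungDiagram.mem_iff_lt_rowLen, h]

open Classical in
/-- The Young diagram with row lengths `f`. When `f` is not a non-increasing function that is
eventually zero, this is the empty diagram. -/
def ofRowLen (f : ℕ → ℕ) : YoungDiagram :=
  if h : Antitone f ∧ ∃ N, f N = 0 then
    { cells := (Finset.range h.2.choose ×ˢ Finset.range (f 0)).filter fun c => c.2 < f c.1
      isLowerSet := by
        rintro ⟨i, j⟩ ⟨i', j'⟩ ⟨hi, hj⟩ hc
        simp only [Finset.coe_filter, Finset.mem_product, Finset.mem_range, Set.mem_ofPred_eq]
          at hc hi hj ⊢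
        have := h.1 hi
        omega }
  else ⊥

theorem rowLen_ofRowLen {f : ℕ → ℕ} (hf : Antitone f) {N : ℕ} (hN : f N = 0) (i : ℕ) :
    (ofRowLen f).rowLen i = f i := by
  have h : Antitone f ∧ ∃ N, f N = 0 := ⟨hf, N, hN⟩
  have key : ∀ j, (i, j) ∈ ofRowLen f ↔ j < f i := by
    intro j
    rw [ofRowLen, dif_pos h, ← YoungDiagram.mem_cells]
    simp only [Finset.mem_filter, Finset.mem_product, Finset.mem_range, and_iff_right_iff_imp]
    intro hj
    refine ⟨?_, hj.trans_le (hf (Nat.zero_le i))⟩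
    by_contra hi
    have := hf (not_lt.1 hi)
    rw [h.2.choose_spec] at this
    omega
  refine le_antisymm (le_of_forall_lt fun j hj => ?_) (le_of_forall_lt fun j hj => ?_)
  · exact (key j).1 (YoungDiagram.mem_iff_lt_rowLen.2 hj)
  · exact YoungDiagram.mem_iff_lt_rowLen.1 ((key j).2 hj)

theorem exists_rowLen_eq_zero (μ : YoungDiagram) : ∃ N, ∀ i, N ≤ i → μ.rowLen i = 0 := by
  obtain ⟨N, hN⟩ := μ.exists_notMem_col 0
  refine ⟨N, fun i hi => ?_⟩
  have h : ¬ 0 < μ.rowLen N := fun h => hN (YoungDiagram.mem_iff_lt_rowLen.2 h)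
  have := μ.rowLen_anti N i hi
  omega

theorem card_eq_sum_rowLen (μ : YoungDiagram) {N : ℕ} (hN : ∀ i, N ≤ i → μ.rowLen i = 0) :
    μ.card = ∑ i ∈ Finset.range N, μ.rowLen i := by
  rw [YoungDiagram.card, Finset.card_eq_sum_card_fiberwise (f := Prod.fst) (t := Finset.range N)]
  · exact Finset.sum_congr rfl fun i _ => (μ.rowLen_eq_card (i := i)).symm
  · rintro ⟨i, j⟩ hc
    have := YoungDiagram.mem_iff_lt_rowLen.1 (μ.mem_cells _ |>.1 hc)
    by_contra hi
    simp only [Finset.coe_range, Set.mem_Iio, not_lt] at hi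
    rw [hN i hi] at this
    omega

theorem exists_common_bound (μ ν : YoungDiagram) :
    ∃ N, (∀ i, N ≤ i → μ.rowLen i = 0) ∧ ∀ i, N ≤ i → ν.rowLen i = 0 := by
  obtain ⟨M, hM⟩ := exists_rowLen_eq_zero μ
  obtain ⟨N, hN⟩ := exists_rowLen_eq_zero ν
  exact ⟨max M N, fun i hi => hM i (le_of_max_le_left hi), fun i hi => hN i (le_of_max_le_right hi)⟩

theorem card_le_card_of_rowLen_le {μ ν : YoungDiagram} (h : ∀ i, μ.rowLen i ≤ ν.rowLen i) :
    μ.card ≤ ν.card := by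
  obtain ⟨N, h1, h2⟩ := exists_common_bound μ ν
  rw [card_eq_sum_rowLen μ h1, card_eq_sum_rowLen ν h2]
  exact Finset.sum_le_sum fun i _ => h i

theorem eq_of_rowLen_le_of_card_le {μ ν : YoungDiagram} (h : ∀ i, μ.rowLen i ≤ ν.rowLen i)
    (hc : ν.card ≤ μ.card) : μ = ν := by
  have hle : μ.cells ⊆ ν.cells := by
    rintro ⟨i, j⟩ hij
    rw [YoungDiagram.mem_cells, YoungDiagram.mem_iff_lt_rowLen] at hij ⊢
    exact hij.trans_le (h i)
  ext1
  exact Finset.eq_of_subset_of_card_le hle hc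

theorem card_eq_sum_rowLens (μ : YoungDiagram) : μ.card = μ.rowLens.sum := by
  rw [card_eq_sum_rowLen μ (N := μ.colLen 0), YoungDiagram.rowLens]
  · rfl
  · intro i hi
    by_contra h
    have : (i, 0) ∈ μ := YoungDiagram.mem_iff_lt_rowLen.2 (Nat.pos_of_ne_zero h)
    rw [YoungDiagram.mem_iff_lt_colLen] at this
    omega

/-- The partition of `n` given by the row lengths of a Young diagram with `n` cells. -/
def toPartition (n : ℕ) (μ : {μ : YoungDiagram // μ.card = n}) : n.Partition where
  parts := μ.1.rowLens
  parts_pos hi := μ.1.pos_of_mem_rowLens _ (by simpa using hi)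
  parts_sum := by rw [Multiset.sum_coe, ← card_eq_sum_rowLens, μ.2]

theorem toPartition_bijective (n : ℕ) : Function.Bijective (toPartition n) := by
  constructor
  · rintro ⟨μ, hμ⟩ ⟨ν, hν⟩ h
    have h1 : (μ.rowLens : Multiset ℕ) = ν.rowLens := congrArg Nat.Partition.parts h
    have h2 : μ.rowLens = ν.rowLens :=
      (Multiset.coe_eq_coe.1 h1).eq_of_sortedGE μ.rowLens_sorted ν.rowLens_sorted
    exact Subtype.ext (YoungDiagram.equivListRowLens.injective (Subtype.ext h2))
  · intro p
    have hs : (p.parts.sort (· ≥ ·)).SortedGE := (p.parts.pairwise_sort _).sortedGE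
    have hpos : ∀ x ∈ p.parts.sort (· ≥ ·), 0 < x := fun x hx =>
      p.parts_pos ((Multiset.mem_sort (r := (· ≥ ·))).1 hx)
    have h1 := YoungDiagram.rowLens_ofRowLens_eq_self (hw := hs) hpos
    refine ⟨⟨YoungDiagram.ofRowLens _ hs, ?_⟩, ?_⟩
    · rw [card_eq_sum_rowLens, h1, ← Multiset.sum_coe, Multiset.sort_eq, p.parts_sum]
    · ext1
      simp [toPartition, h1]

/-- The finite set of all Young diagrams with `n` cells. -/
def diagrams (n : ℕ) : Finset YoungDiagram :=
  haveI : Finite {μ : YoungDiagram // μ.card = n} :=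
    Finite.of_injective _ (toPartition_bijective n).1
  (Set.finite_range (Subtype.val : {μ : YoungDiagram // μ.card = n} → YoungDiagram)).toFinset

@[simp]
theorem mem_diagrams {n : ℕ} {μ : YoungDiagram} : μ ∈ diagrams n ↔ μ.card = n := by
  simp [diagrams]

theorem card_diagrams (n : ℕ) : (diagrams n).card = Fintype.card n.Partition := by
  rw [← Fintype.card_coe]
  exact Fintype.card_of_bijective
    (f := fun μ : diagrams n => toPartition n ⟨μ.1, mem_diagrams.1 μ.2⟩)
    ((toPartition_bijective n).comp
      (Equiv.subtypeEquivRight (fun μ => mem_diagrams (n := n) (μ := μ))).bijective)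

/-- The skew shape `μ / κ` is a horizontal strip: it has at most one cell in each column. In terms
of row lengths, those of `κ` interlace with those of `μ`. -/
def IsHorizontalStrip (μ κ : YoungDiagram) : Prop :=
  ∀ i, κ.rowLen i ≤ μ.rowLen i ∧ μ.rowLen (i + 1) ≤ κ.rowLen i

/-- The skew shape `μ / κ` is a vertical strip: it has at most one cell in each row. -/
def IsVerticalStrip (μ κ : YoungDiagram) : Prop :=
  ∀ i, κ.rowLen i ≤ μ.rowLen i ∧ μ.rowLen i ≤ κ.rowLen i + 1

theorem rowLen_ofRowLen_of_interlace {μ : YoungDiagram} {f : ℕ → ℕ}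
    (hf : ∀ i, f i ≤ μ.rowLen i ∧ μ.rowLen (i + 1) ≤ f i) (i : ℕ) :
    (ofRowLen f).rowLen i = f i := by
  obtain ⟨N, hN⟩ := exists_rowLen_eq_zero μ
  refine rowLen_ofRowLen (antitone_nat_of_succ_le fun i => (hf (i + 1)).1.trans (hf i).2)
    (N := N) ?_ i
  have := (hf N).1
  rw [hN N le_rfl] at this
  omega

/-- The largest `i`-th row length that a diagram `κ` with `μ / κ` and `κ / ν` horizontal strips can
have. -/
def upperRow (μ ν : YoungDiagram) : ℕ → ℕ
  | 0 => μ.rowLen 0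
  | i + 1 => min (μ.rowLen (i + 1)) (ν.rowLen i)

/-- The smallest `i`-th row length that a diagram `κ` with `μ / κ` and `κ / ν` horizontal strips can
have. -/
def lowerRow (μ ν : YoungDiagram) (i : ℕ) : ℕ := max (ν.rowLen i) (μ.rowLen (i + 1))

/-- Between `ν` and `μ`, the row lengths of `κ` vary in a box, independently of each other. -/
theorem isHorizontalStrip_and_iff {μ κ ν : YoungDiagram} :
    IsHorizontalStrip κ ν ∧ IsHorizontalStrip μ κ ↔
      ∀ i, lowerRow μ ν i ≤ κ.rowLen i ∧ κ.rowLen i ≤ upperRow μ ν i := by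
  constructor
  · rintro ⟨h1, h2⟩ (_ | i)
    · have := h1 0; have := h2 0
      simp only [lowerRow, upperRow]; omega
    · have := h1 (i + 1); have := h2 (i + 1); have := h1 i
      simp only [lowerRow, upperRow]; omega
  · intro h
    refine ⟨fun i => ?_, fun i => ?_⟩
    · have h1 := h i; have h2 := h (i + 1)
      simp only [lowerRow, upperRow] at h1 h2; omega
    · have h1 := h i
      cases i <;> simp only [lowerRow, upperRow] at h1 <;> omega

/-- The centre of the box of all `κ` between `ν` and `μ` has size `(|μ| + |ν|) / 2`, since
`max a b + min a b = a + b`. -/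
theorem sum_lowerRow_add_upperRow (μ ν : YoungDiagram) {N : ℕ}
    (hμ : ∀ i, N ≤ i → μ.rowLen i = 0) (hν : ∀ i, N ≤ i → ν.rowLen i = 0) :
    ∑ i ∈ Finset.range (N + 1), (lowerRow μ ν i + upperRow μ ν i) = μ.card + ν.card := by
  have h1 : lowerRow μ ν N = 0 := by simp [lowerRow, hμ, hν]
  -- After shifting the index of `upperRow`, both summands involve the same two numbers.
  have h2 : ∀ i, lowerRow μ ν i + upperRow μ ν (i + 1) = ν.rowLen i + μ.rowLen (i + 1) := by
    intro i; simp only [lowerRow, upperRow]; omega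
  rw [card_eq_sum_rowLen μ (N := N + 1) fun i hi => hμ i (by omega), card_eq_sum_rowLen ν hν,
    Finset.sum_add_distrib, Finset.sum_range_succ, h1, Finset.sum_range_succ' (upperRow μ ν),
    Finset.sum_range_succ' μ.rowLen]
  have h3 := Finset.sum_congr (rfl : Finset.range N = Finset.range N) fun i _ => h2 i
  rw [Finset.sum_add_distrib, Finset.sum_add_distrib] at h3
  simp only [upperRow] at h3 ⊢
  omega

/-- The reflection of `κ` in the box of all diagrams that lie between `ν` and `μ` with two
horizontal strips as differences. It exchanges the sizes of the two strips. -/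
def reflect (μ ν κ : YoungDiagram) : YoungDiagram :=
  ofRowLen fun i => lowerRow μ ν i + upperRow μ ν i - κ.rowLen i

theorem rowLen_reflect {μ ν κ : YoungDiagram}
    (h : ∀ i, lowerRow μ ν i ≤ κ.rowLen i ∧ κ.rowLen i ≤ upperRow μ ν i) (i : ℕ) :
    (reflect μ ν κ).rowLen i = lowerRow μ ν i + upperRow μ ν i - κ.rowLen i := by
  refine rowLen_ofRowLen_of_interlace (μ := μ) (fun i => ?_) i
  have h1 := h i
  cases i <;> simp only [lowerRow, upperRow] at h1 ⊢ <;> omega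

open Classical in
theorem card_horizontal_horizontal_le (μ ν : YoungDiagram) {r s : ℕ}
    (hμ : μ.card = ν.card + (r + s)) :
    ((diagrams (ν.card + r)).filter fun κ => IsHorizontalStrip κ ν ∧ IsHorizontalStrip μ κ).card ≤
    ((diagrams (ν.card + s)).filter fun κ =>
      IsHorizontalStrip κ ν ∧ IsHorizontalStrip μ κ).card := by
  simp only [isHorizontalStrip_and_iff]
  refine Finset.card_le_card_of_injOn (reflect μ ν) (fun κ hκ => ?_) fun κ hκ κ' hκ' he => ?_
  · simp only [Finset.coe_filter, mem_diagrams, Set.mem_ofPred_eq] at hκ ⊢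
    obtain ⟨hc, h⟩ := hκ
    refine ⟨?_, fun i => ?_⟩
    · obtain ⟨N, h1, h2⟩ := exists_common_bound μ ν
      have hz : ∀ i, N + 1 ≤ i → lowerRow μ ν i = 0 ∧ upperRow μ ν i = 0 := by
        rintro (_ | i) hi
        · omega
        · simp [lowerRow, upperRow, h1 (i + 1) (by omega), h1 (i + 1 + 1) (by omega),
            h2 (i + 1) (by omega)]
      have h3 : ∀ i, N + 1 ≤ i → κ.rowLen i = 0 := fun i hi => by
        have := h i; have := hz i hi; omega
      have h4 : ∀ i, N + 1 ≤ i → (reflect μ ν κ).rowLen i = 0 := fun i hi => by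
        rw [rowLen_reflect h]; have := hz i hi; omega
      have h5 : (reflect μ ν κ).card + κ.card = μ.card + ν.card := by
        rw [card_eq_sum_rowLen _ h3, card_eq_sum_rowLen _ h4, ← sum_lowerRow_add_upperRow μ ν h1 h2,
          ← Finset.sum_add_distrib]
        refine Finset.sum_congr rfl fun i _ => ?_
        rw [rowLen_reflect h]; have := h i; omega
      omega
    · rw [rowLen_reflect h]; have := h i; omega
  · simp only [Finset.coe_filter, mem_diagrams, Set.mem_ofPred_eq] at hκ hκ'
    refine rowLen_injective (funext fun i => ?_)
    have h1 := congrArg (fun κ => κ.rowLen i) he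
    simp only [rowLen_reflect hκ.2, rowLen_reflect hκ'.2] at h1
    have := hκ.2 i; have := hκ'.2 i
    omega

open Classical in
/-- The number of ways to go from `μ` to `ν` by removing two horizontal strips does not depend on the
order of their sizes. This is the symmetry of (skew) Schur functions in two variables. -/
theorem card_horizontal_horizontal_comm (μ ν : YoungDiagram) {r s : ℕ}
    (hμ : μ.card = ν.card + (r + s)) :
    ((diagrams (ν.card + r)).filter fun κ => IsHorizontalStrip κ ν ∧ IsHorizontalStrip μ κ).card =
    ((diagrams (ν.card + s)).filter fun κ => IsHorizontalStrip κ ν ∧ IsHorizontalStrip μ κ).card :=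
  le_antisymm (card_horizontal_horizontal_le μ ν hμ)
    (card_horizontal_horizontal_le μ ν (by rw [hμ, add_comm r s]))

open Classical in
/-- The last row in which `μ` and `ν` differ (`0` if `μ = ν`). -/
def lastRow (μ ν : YoungDiagram) : ℕ :=
  Nat.findGreatest (fun i => μ.rowLen i ≠ ν.rowLen i) (exists_common_bound μ ν).choose

theorem lastRow_spec {μ ν : YoungDiagram} (h : μ ≠ ν) :
    μ.rowLen (lastRow μ ν) ≠ ν.rowLen (lastRow μ ν) ∧
      ∀ i, lastRow μ ν < i → μ.rowLen i = ν.rowLen i := by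
  classical
  have hN := (exists_common_bound μ ν).choose_spec
  have hlarge : ∀ i, μ.rowLen i ≠ ν.rowLen i → i ≤ (exists_common_bound μ ν).choose := by
    intro i hi
    by_contra hlt
    exact hi (by rw [hN.1 i (by omega), hN.2 i (by omega)])
  obtain ⟨i, hi⟩ : ∃ i, μ.rowLen i ≠ ν.rowLen i := by
    by_contra! hall
    exact h (rowLen_injective (funext hall))
  refine ⟨Nat.findGreatest_spec (P := fun i => μ.rowLen i ≠ ν.rowLen i) (hlarge i hi) hi,
    fun j hj => ?_⟩
  by_contra hne
  exact Nat.findGreatest_is_greatest hj (hlarge j hne) hne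

/-- The sign-reversing involution on the diagrams `κ` between `ν` and `μ` with `κ / ν` a vertical
and `μ / κ` a horizontal strip: in the last row in which `μ` and `ν` differ, the length of the row of
`κ` is switched between its two possible values. -/
def toggle (μ ν κ : YoungDiagram) : YoungDiagram :=
  ofRowLen fun i => if i = lastRow μ ν then 2 * ν.rowLen i + 1 - κ.rowLen i else κ.rowLen i

theorem toggle_spec {μ ν κ : YoungDiagram} (hne : μ ≠ ν) (h1 : IsVerticalStrip κ ν)
    (h2 : IsHorizontalStrip μ κ) :
    (∀ i, (toggle μ ν κ).rowLen i =
      if i = lastRow μ ν then 2 * ν.rowLen i + 1 - κ.rowLen i else κ.rowLen i) ∧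
    IsVerticalStrip (toggle μ ν κ) ν ∧ IsHorizontalStrip μ (toggle μ ν κ) := by
  obtain ⟨h3, h4⟩ := lastRow_spec hne
  have hf : ∀ i, (if i = lastRow μ ν then 2 * ν.rowLen i + 1 - κ.rowLen i else κ.rowLen i) ≤
      μ.rowLen i ∧ μ.rowLen (i + 1) ≤
      if i = lastRow μ ν then 2 * ν.rowLen i + 1 - κ.rowLen i else κ.rowLen i := by
    intro i
    have h5 := h1 i
    have h6 := h2 i
    split_ifs with hi
    · subst hi
      -- Below the last row where they differ, `μ` and `ν` agree, so both values are admissible.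
      have h7 := h4 _ (Nat.lt_succ_self _)
      have h8 := ν.rowLen_anti _ _ (Nat.le_succ (lastRow μ ν))
      simp only [Nat.succ_eq_add_one] at h7 h8
      omega
    · exact h6
  have hrow := rowLen_ofRowLen_of_interlace hf
  refine ⟨hrow, fun i => ?_, fun i => ?_⟩
  · rw [toggle, hrow]
    have := h1 i
    split_ifs <;> omega
  · rw [toggle, hrow]
    exact hf i

theorem toggle_toggle {μ ν κ : YoungDiagram} (hne : μ ≠ ν) (h1 : IsVerticalStrip κ ν)
    (h2 : IsHorizontalStrip μ κ) : toggle μ ν (toggle μ ν κ) = κ := by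
  obtain ⟨h3, h4, h5⟩ := toggle_spec hne h1 h2
  refine rowLen_injective (funext fun i => ?_)
  rw [(toggle_spec hne h4 h5).1, h3]
  have := h1 i
  split_ifs <;> omega

theorem neg_one_pow_card_toggle {μ ν κ : YoungDiagram} (hne : μ ≠ ν) (h1 : IsVerticalStrip κ ν)
    (h2 : IsHorizontalStrip μ κ) :
    (-1 : ℤ) ^ (toggle μ ν κ).card = - (-1) ^ κ.card := by
  obtain ⟨h3, -, -⟩ := toggle_spec hne h1 h2
  obtain ⟨N, h4, h5⟩ := exists_common_bound κ (toggle μ ν κ)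
  obtain ⟨M, hM, hMl⟩ : ∃ M, N ≤ M ∧ lastRow μ ν < M := ⟨N + lastRow μ ν + 1, by omega, by omega⟩
  rw [card_eq_sum_rowLen κ (N := M) fun i hi => h4 i (by omega),
    card_eq_sum_rowLen (toggle μ ν κ) (N := M) fun i hi => h5 i (by omega),
    ← Finset.add_sum_erase _ κ.rowLen (Finset.mem_range.2 hMl),
    ← Finset.add_sum_erase _ (toggle μ ν κ).rowLen (Finset.mem_range.2 hMl)]
  have h6 : ∑ x ∈ (Finset.range M).erase (lastRow μ ν), (toggle μ ν κ).rowLen x =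
      ∑ x ∈ (Finset.range M).erase (lastRow μ ν), κ.rowLen x :=
    Finset.sum_congr rfl fun i hi => by rw [h3, if_neg (Finset.ne_of_mem_erase hi)]
  rw [h6, h3, if_pos rfl, pow_add, pow_add, ← neg_mul]
  congr 1
  have h7 := h1 (lastRow μ ν)
  obtain h8 | h8 : κ.rowLen (lastRow μ ν) = ν.rowLen (lastRow μ ν) ∨
      κ.rowLen (lastRow μ ν) = ν.rowLen (lastRow μ ν) + 1 := by omega
  · rw [h8, show 2 * ν.rowLen (lastRow μ ν) + 1 - ν.rowLen (lastRow μ ν) =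
      ν.rowLen (lastRow μ ν) + 1 by omega, pow_succ]
    ring
  · rw [h8, show 2 * ν.rowLen (lastRow μ ν) + 1 - (ν.rowLen (lastRow μ ν) + 1) =
      ν.rowLen (lastRow μ ν) by omega, pow_succ]
    ring

open Classical in
/-- The combinatorial form of the relation `∑ (-1)^i e_i h_{n-i} = 0`. -/
theorem sum_neg_one_pow_card_vertical_horizontal (μ ν : YoungDiagram) {n : ℕ} (hn : n ≠ 0)
    (hμ : μ.card = ν.card + n) :
    ∑ i ∈ Finset.range (n + 1), (-1 : ℤ) ^ i *
      ((diagrams (ν.card + i)).filter fun κ => IsVerticalStrip κ ν ∧ IsHorizontalStrip μ κ).card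
      = 0 := by
  have hne : μ ≠ ν := by rintro rfl; omega
  have h1 : ∀ i ∈ Finset.range (n + 1), (-1 : ℤ) ^ i *
      ((diagrams (ν.card + i)).filter fun κ => IsVerticalStrip κ ν ∧ IsHorizontalStrip μ κ).card =
      ∑ κ ∈ (diagrams (ν.card + i)).filter fun κ => IsVerticalStrip κ ν ∧ IsHorizontalStrip μ κ,
        (-1) ^ ν.card * (-1) ^ κ.card := by
    intro i _
    rw [Finset.sum_congr rfl (g := fun _ => (-1 : ℤ) ^ i), Finset.sum_const, nsmul_eq_mul, mul_comm]
    intro κ hκ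
    rw [(mem_diagrams.1 (Finset.mem_filter.1 hκ).1), pow_add, ← mul_assoc, ← pow_add, ← two_mul,
      pow_mul]
    simp
  rw [Finset.sum_congr rfl h1, ← Finset.sum_biUnion]
  · refine Finset.sum_involution (fun κ _ => toggle μ ν κ) ?_ ?_ ?_ ?_
    · intro κ hκ
      simp only [Finset.mem_biUnion, Finset.mem_filter] at hκ
      obtain ⟨i, -, -, h2, h3⟩ := hκ
      rw [neg_one_pow_card_toggle hne h2 h3]
      ring
    · intro κ hκ _ heq
      simp only [Finset.mem_biUnion, Finset.mem_filter] at hκ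
      obtain ⟨i, -, -, h2, h3⟩ := hκ
      have h4 := neg_one_pow_card_toggle hne h2 h3
      rw [heq] at h4
      have h5 : (-1 : ℤ) ^ κ.card ≠ 0 := pow_ne_zero _ (by norm_num)
      omega
    · intro κ hκ
      simp only [Finset.mem_biUnion, Finset.mem_filter] at hκ ⊢
      obtain ⟨i, -, -, h2, h3⟩ := hκ
      obtain ⟨-, h4, h5⟩ := toggle_spec hne h2 h3
      have h6 := card_le_card_of_rowLen_le fun i => (h4 i).1
      have h7 := card_le_card_of_rowLen_le fun i => (h5 i).1
      exact ⟨(toggle μ ν κ).card - ν.card, by simp; omega, by simp; omega, h4, h5⟩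
    · intro κ hκ
      simp only [Finset.mem_biUnion, Finset.mem_filter] at hκ
      obtain ⟨i, -, -, h2, h3⟩ := hκ
      exact toggle_toggle hne h2 h3
  · intro i _ j _ hij
    refine Finset.disjoint_left.2 fun κ h2 h3 => hij ?_
    simp only [Finset.mem_filter, mem_diagrams] at h2 h3
    omega

/-! ### The operators that remove strips -/

section Operators

variable (K : Type*) [Field K]

open Classical in
/-- The linear operator that removes skew shapes `μ / κ` with `R μ κ` and with `r` cells: it is
the transpose of `κ ↦ ∑ μ`, summed over all `μ` with `R μ κ` and `|μ| = |κ| + r`. A function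
`g : YoungDiagram → K` stands for the formal sum `∑ g μ • S_μ`. -/
def stripOp (R : YoungDiagram → YoungDiagram → Prop) (r : ℕ) : Module.End K (YoungDiagram → K) where
  toFun g κ := ∑ μ ∈ (diagrams (κ.card + r)).filter fun μ => R μ κ, g μ
  map_add' g g' := by ext κ; simp [Finset.sum_add_distrib]
  map_smul' c g := by ext κ; simp [Finset.mul_sum]

/-- The operator removing horizontal strips of size `r`; on symmetric functions it is the adjoint of
the multiplication by the complete homogeneous symmetric function `h_r`. -/
def hOp (r : ℕ) : Module.End K (YoungDiagram → K) := stripOp K IsHorizontalStrip r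

/-- The operator removing vertical strips of size `r`; on symmetric functions it is the adjoint of
the multiplication by the elementary symmetric function `e_r`. -/
def eOp (r : ℕ) : Module.End K (YoungDiagram → K) := stripOp K IsVerticalStrip r

variable {K}

open Classical in
theorem stripOp_apply (R : YoungDiagram → YoungDiagram → Prop) (r : ℕ) (g : YoungDiagram → K)
    (κ : YoungDiagram) :
    stripOp K R r g κ = ∑ μ ∈ diagrams (κ.card + r), if R μ κ then g μ else 0 := by
  rw [← Finset.sum_filter]
  rfl

open Classical in
theorem stripOp_mul_stripOp_apply (R S : YoungDiagram → YoungDiagram → Prop) (r s : ℕ)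
    (g : YoungDiagram → K) (ν : YoungDiagram) :
    (stripOp K R r * stripOp K S s) g ν = ∑ μ ∈ diagrams (ν.card + (r + s)),
      (((diagrams (ν.card + r)).filter fun κ => R κ ν ∧ S μ κ).card : K) * g μ := by
  rw [Module.End.mul_apply, stripOp_apply]
  have h : ∀ κ ∈ diagrams (ν.card + r), (if R κ ν then stripOp K S s g κ else 0) =
      ∑ μ ∈ diagrams (ν.card + (r + s)), if R κ ν ∧ S μ κ then g μ else 0 := by
    intro κ hκ
    rw [stripOp_apply, mem_diagrams.1 hκ, add_assoc]
    split_ifs with hR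
    · simp [hR]
    · simp [hR]
  rw [Finset.sum_congr rfl h, Finset.sum_comm]
  refine Finset.sum_congr rfl fun μ _ => ?_
  rw [← Finset.sum_filter, Finset.sum_const, nsmul_eq_mul]

theorem stripOp_zero {R : YoungDiagram → YoungDiagram → Prop} (hR : ∀ μ, R μ μ)
    (hle : ∀ μ κ, R μ κ → ∀ i, κ.rowLen i ≤ μ.rowLen i) : stripOp K R 0 = 1 := by
  classical
  refine LinearMap.ext fun g => funext fun κ => ?_
  rw [stripOp_apply, Finset.sum_eq_single κ]
  · simp [hR]
  · intro μ hμ hne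
    refine if_neg fun h => hne ?_
    exact (eq_of_rowLen_le_of_card_le (hle μ κ h) (by simp [mem_diagrams.1 hμ])).symm
  · simp

theorem hOp_zero : hOp K 0 = 1 :=
  stripOp_zero (fun μ i => ⟨le_rfl, μ.rowLen_anti _ _ (Nat.le_succ i)⟩) fun _ _ h i => (h i).1

theorem eOp_zero : eOp K 0 = 1 :=
  stripOp_zero (fun _ _ => ⟨le_rfl, Nat.le_succ _⟩) fun _ _ h i => (h i).1

theorem hOp_mul_comm (r s : ℕ) : hOp K r * hOp K s = hOp K s * hOp K r := by
  refine LinearMap.ext fun g => funext fun ν => ?_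
  rw [hOp, hOp, stripOp_mul_stripOp_apply, stripOp_mul_stripOp_apply, add_comm s r]
  refine Finset.sum_congr rfl fun μ hμ => ?_
  rw [card_horizontal_horizontal_comm μ ν (mem_diagrams.1 hμ)]

theorem sum_eOp_mul_hOp {n : ℕ} (hn : n ≠ 0) :
    ∑ i ∈ Finset.range (n + 1), (-1 : K) ^ i • (eOp K i * hOp K (n - i)) = 0 := by
  refine LinearMap.ext fun g => funext fun ν => ?_
  classical
  have h : ∀ i ∈ Finset.range (n + 1), ((-1 : K) ^ i • (eOp K i * hOp K (n - i))) g ν =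
      ∑ μ ∈ diagrams (ν.card + n), (((-1 : ℤ) ^ i * ((diagrams (ν.card + i)).filter fun κ =>
        IsVerticalStrip κ ν ∧ IsHorizontalStrip μ κ).card : ℤ) : K) * g μ := by
    intro i hi
    rw [LinearMap.smul_apply, Pi.smul_apply, eOp, hOp, stripOp_mul_stripOp_apply,
      Nat.add_sub_cancel' (Nat.lt_succ_iff.1 (Finset.mem_range.1 hi)), Finset.smul_sum]
    refine Finset.sum_congr rfl fun μ _ => ?_
    push_cast
    rw [smul_eq_mul, mul_assoc]
  rw [LinearMap.sum_apply, Finset.sum_apply, Finset.sum_congr rfl h, Finset.sum_comm]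
  refine Finset.sum_eq_zero fun μ hμ => ?_
  rw [← Finset.sum_mul, ← Int.cast_sum,
    sum_neg_one_pow_card_vertical_horizontal μ ν hn (mem_diagrams.1 hμ)]
  simp

variable (K) in
/-- The operators that lower the degree by `r`: the value of `a g` at a diagram with `k` cells
depends only on the values of `g` at the diagrams with `k + r` cells. -/
def lowering (r : ℕ) : Submodule K (Module.End K (YoungDiagram → K)) where
  carrier := {a | ∀ g κ, (∀ μ, μ.card = κ.card + r → g μ = 0) → a g κ = 0}
  zero_mem' := fun _ _ _ => rfl
  add_mem' := fun ha hb g κ h => by simp [ha g κ h, hb g κ h]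
  smul_mem' := fun c a ha g κ h => by simp [ha g κ h]

theorem mem_lowering {r : ℕ} {a : Module.End K (YoungDiagram → K)} :
    a ∈ lowering K r ↔ ∀ g κ, (∀ μ, μ.card = κ.card + r → g μ = 0) → a g κ = 0 := Iff.rfl

theorem stripOp_mem_lowering (R : YoungDiagram → YoungDiagram → Prop) (r : ℕ) :
    stripOp K R r ∈ lowering K r := fun g κ h => by
  classical
  rw [stripOp_apply]
  exact Finset.sum_eq_zero fun μ hμ => by rw [h μ (mem_diagrams.1 hμ), ite_self]

theorem one_mem_lowering : (1 : Module.End K (YoungDiagram → K)) ∈ lowering K 0 :=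
  fun _ κ h => h κ rfl

theorem mul_mem_lowering {r s : ℕ} {a b : Module.End K (YoungDiagram → K)}
    (ha : a ∈ lowering K r) (hb : b ∈ lowering K s) : a * b ∈ lowering K (r + s) :=
  fun g κ h => ha _ κ fun μ hμ => hb g μ fun ρ hρ => h ρ (by omega)

/-- The diagram obtained by deleting the first row. -/
def removeRow (μ : YoungDiagram) : YoungDiagram := ofRowLen fun i => μ.rowLen (i + 1)

theorem rowLen_removeRow (μ : YoungDiagram) (i : ℕ) :
    (removeRow μ).rowLen i = μ.rowLen (i + 1) :=
  rowLen_ofRowLen_of_interlace (μ := μ) (fun i => ⟨μ.rowLen_anti _ _ (Nat.le_succ i), le_rfl⟩) i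

theorem card_eq_rowLen_add_removeRow (μ : YoungDiagram) :
    μ.card = (removeRow μ).card + μ.rowLen 0 := by
  obtain ⟨N, hN⟩ := exists_rowLen_eq_zero μ
  rw [card_eq_sum_rowLen μ (N := N + 1) fun i hi => hN i (by omega),
    card_eq_sum_rowLen (removeRow μ) (N := N) fun i hi => by
      rw [rowLen_removeRow]; exact hN _ (by omega), Finset.sum_range_succ']
  simp only [rowLen_removeRow]

/-- No nonzero `g` of positive degree is killed by all `hOp K r` with `r ≥ 1`: if `μ` has the longest
first row among the diagrams in the support of `g`, then removing horizontal strips of this length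
from `g`, only `μ` contributes to the coefficient of `μ` without its first row. -/
theorem apply_eq_zero_of_hOp_apply_eq_zero {n : ℕ} (hn : n ≠ 0) {g : YoungDiagram → K}
    (H : ∀ r, r ≠ 0 → ∀ κ, κ.card + r = n → hOp K r g κ = 0) {μ : YoungDiagram}
    (hμ : μ.card = n) : g μ = 0 := by
  classical
  by_contra hne
  obtain ⟨ρ, hρ, hmax⟩ := Finset.exists_max_image ((diagrams n).filter fun μ => g μ ≠ 0)
    (fun μ => μ.rowLen 0) ⟨μ, by simp [hμ, hne]⟩
  simp only [Finset.mem_filter, mem_diagrams] at hρ hmax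
  have hcard := card_eq_rowLen_add_removeRow ρ
  have h0 : ρ.rowLen 0 ≠ 0 := by
    intro h0
    obtain ⟨N, hN⟩ := exists_rowLen_eq_zero ρ
    rw [card_eq_sum_rowLen ρ hN, Finset.sum_eq_zero] at hρ
    · exact hn hρ.1.symm
    · intro i _
      have := ρ.rowLen_anti 0 i (Nat.zero_le i)
      omega
  have h1 := H (ρ.rowLen 0) h0 (removeRow ρ) (by omega)
  rw [hOp, stripOp_apply, ← hcard, Finset.sum_eq_single ρ] at h1
  · rw [if_pos] at h1
    · exact hρ.2 h1
    · intro i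
      rw [rowLen_removeRow]
      exact ⟨ρ.rowLen_anti _ _ (Nat.le_succ i), le_rfl⟩
  · intro τ hτ hτρ
    rw [ite_eq_right_iff]
    intro hstrip
    by_contra hgτ
    rw [mem_diagrams] at hτ
    have h2 := hmax τ ⟨hτ.trans hρ.1, hgτ⟩
    refine hτρ (eq_of_rowLen_le_of_card_le (fun i => ?_) hτ.ge)
    cases i with
    | zero => exact h2
    | succ i => exact (hstrip i).2.trans_eq (rowLen_removeRow ρ i)
  · simp

theorem card_eq_zero_iff {μ : YoungDiagram} : μ.card = 0 ↔ μ = ⊥ := by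
  rw [YoungDiagram.card, Finset.card_eq_zero]
  exact ⟨fun h => by ext1; simpa using h, fun h => by simp [h]⟩

/-- A function on Young diagrams is determined by the values at the empty diagram after removing
horizontal strips in all possible ways. -/
theorem eq_zero_of_prod_hOp_apply_bot {g : YoungDiagram → K}
    (H : ∀ l : List ℕ, (l.map (hOp K)).prod g ⊥ = 0) : g = 0 := by
  funext μ
  induction hn : μ.card using Nat.strong_induction_on generalizing g μ with
  | _ n ih =>
    by_cases h0 : n = 0
    · have := H []
      rw [card_eq_zero_iff.1 (hn.trans h0)]
      simpa using this
    · refine apply_eq_zero_of_hOp_apply_eq_zero h0 (fun r hr κ hκ => ?_) hn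
      refine ih κ.card (by omega) (fun l => ?_) κ rfl
      have := H (l ++ [r])
      simpa using this

end Operators

/-! ### Complete, elementary and power sum generating functions -/

section PowerSums

open PowerSeries

variable {B : Type*} [CommRing B]

theorem coeff_evalNegHom (F : B⟦X⟧) (n : ℕ) :
    coeff n (evalNegHom F) = (-1) ^ n * coeff n F := by
  simp only [evalNegHom, coeff_rescale]

theorem derivative_evalNegHom (F : B⟦X⟧) :
    derivative B (evalNegHom F) = - evalNegHom (derivative B F) := by
  ext n
  simp only [coeff_evalNegHom, coeff_derivative, map_neg, pow_succ]
  ring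

theorem evalNegHom_evalNegHom (F : B⟦X⟧) : evalNegHom (evalNegHom F) = F := by
  ext n
  simp only [coeff_evalNegHom, ← mul_assoc, ← mul_pow]
  simp

theorem map_evalNegHom {C : Type*} [CommRing C] (φ : B →+* C) (F : B⟦X⟧) :
    PowerSeries.map φ (evalNegHom F) = evalNegHom (PowerSeries.map φ F) := by
  ext n
  simp [coeff_evalNegHom]

theorem map_derivative {C : Type*} [CommRing C] (φ : B →+* C) (F : B⟦X⟧) :
    PowerSeries.map φ (derivative B F) = derivative C (PowerSeries.map φ F) := by
  ext n
  simp [coeff_derivative]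

theorem eq_zero_of_mul_succ_eq_zero (K : Type*) [Field K] [CharZero K] [Algebra K B]
    {b : B} {n : ℕ} (hb : b * ((n : B) + 1) = 0) : b = 0 := by
  have h1 : ((n : K) + 1) • b = 0 := by
    rw [Algebra.smul_def, mul_comm]
    simpa using hb
  have h2 : (n : K) + 1 ≠ 0 := by exact_mod_cast Nat.succ_ne_zero n
  exact (smul_eq_zero_iff_right h2).1 h1

/-- For `H` invertible, `H(t) H(-t) = 1` if and only if the logarithmic derivative `P = H' / H` is
an even power series: `P(t) - P(-t)` is the logarithmic derivative of `H(t) H(-t)`. -/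
theorem mul_evalNegHom_eq_one_iff (K : Type*) [Field K] [CharZero K] [Algebra K B]
    {H G : B⟦X⟧} (hH : coeff 0 H = 1) (hG : G * H = 1) :
    H * evalNegHom H = 1 ↔ evalNegHom (derivative B H * G) = derivative B H * G := by
  set P := derivative B H * G with hP
  have hder : derivative B H = P * H := by rw [hP, mul_assoc, hG, mul_one]
  have hder' : derivative B (H * evalNegHom H) = (P - evalNegHom P) * (H * evalNegHom H) := by
    rw [Derivation.leibniz, derivative_evalNegHom, hder, map_mul]
    simp only [smul_eq_mul]
    ring
  constructor
  · intro h
    rw [h, mul_one, Derivation.map_one_eq_zero] at hder'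
    exact (sub_eq_zero.1 hder'.symm).symm
  · intro h
    rw [h, sub_self, zero_mul] at hder'
    ext n
    cases n with
    | zero => simp [coeff_mul, coeff_evalNegHom, hH]
    | succ n =>
      have h1 := congrArg (coeff n) hder'
      rw [coeff_derivative, map_zero] at h1
      rw [eq_zero_of_mul_succ_eq_zero K h1, coeff_one, if_neg (Nat.succ_ne_zero n)]

theorem evalNegHom_eq_self_iff (K : Type*) [Field K] [CharZero K] [Algebra K B]
    (F : B⟦X⟧) :
    evalNegHom F = F ↔ ∀ i, coeff (2 * i + 1) F = 0 := by
  constructor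
  · intro h i
    have h1 := congrArg (coeff (2 * i + 1)) h
    rw [coeff_evalNegHom, Odd.neg_one_pow ⟨i, rfl⟩] at h1
    refine eq_zero_of_mul_succ_eq_zero K (n := 1) ?_
    linear_combination -h1
  · intro h
    ext n
    rw [coeff_evalNegHom]
    obtain ⟨i, rfl⟩ | ⟨i, rfl⟩ := Nat.even_or_odd n
    · simp
    · simp [h]

/-- Let `H` and `E` be the generating functions of the complete and elementary symmetric functions,
so that `E(-t) H(t) = 1`. Then `P = H' / H` generates the power sums `p_1, p_2, …`, and `h_r ≡ e_r`
for all `r` modulo an ideal if and only if `p_2, p_4, …` lie in the ideal. -/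
theorem forall_coeff_sub_mem_iff (K : Type*) [Field K] [CharZero K] [Algebra K B]
    {H E : B⟦X⟧} (hH : coeff 0 H = 1)
    (hE : evalNegHom E * H = 1) (I : Ideal B) :
    (∀ r, coeff r H - coeff r E ∈ I) ↔
      ∀ i, coeff (2 * i + 1) (derivative B H * evalNegHom E) ∈ I := by
  set φ := Ideal.Quotient.mk I
  have h1 : coeff 0 (PowerSeries.map φ H) = 1 := by rw [coeff_map, hH, map_one]
  have h2 : PowerSeries.map φ (evalNegHom E) * PowerSeries.map φ H = 1 := by
    rw [← map_mul, hE, map_one]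
  have h3 := (mul_evalNegHom_eq_one_iff K h1 h2).trans (evalNegHom_eq_self_iff K _)
  have h4 : (∀ r, coeff r H - coeff r E ∈ I) ↔ PowerSeries.map φ H = PowerSeries.map φ E := by
    rw [PowerSeries.ext_iff]
    exact forall_congr' fun r => by rw [coeff_map, coeff_map, Ideal.Quotient.mk_eq_mk_iff_sub_mem]
  have h5 : PowerSeries.map φ H = PowerSeries.map φ E ↔
      PowerSeries.map φ H * evalNegHom (PowerSeries.map φ H) = 1 := by
    rw [map_evalNegHom] at h2
    constructor
    · intro h
      rw [← h, mul_comm] at h2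
      exact h2
    · intro h
      have h6 : evalNegHom (PowerSeries.map φ H) = evalNegHom (PowerSeries.map φ E) := by
        rw [← mul_one (evalNegHom (PowerSeries.map φ E)), ← h, ← mul_assoc, h2, one_mul]
      rw [← evalNegHom_evalNegHom (PowerSeries.map φ H), h6, evalNegHom_evalNegHom]
  rw [h4, h5, h3]
  refine forall_congr' fun i => ?_
  rw [← map_derivative, ← map_mul, coeff_map, Ideal.Quotient.eq_zero_iff_mem]

/-- Newton's identities `n h_n = ∑ p_i h_{n-i}`, the coefficients of `H' = P H`, express the `h_n` by
the power sums in characteristic zero. -/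
theorem coeff_mem_adjoin_powerSums (K : Type*) [Field K] [CharZero K] [Algebra K B]
    {H G : B⟦X⟧} (hH : coeff 0 H = 1) (hG : G * H = 1) (n : ℕ) :
    coeff n H ∈ Algebra.adjoin K (Set.range fun i => coeff i (X * (derivative B H * G))) := by
  induction n using Nat.strong_induction_on with
  | _ n ih =>
    cases n with
    | zero => rw [hH]; exact one_mem _
    | succ n =>
      have hder : derivative B H = derivative B H * G * H := by rw [mul_assoc, hG, mul_one]
      have h1 := congrArg (coeff n) hder
      rw [coeff_derivative, coeff_mul] at h1
      have h2 : ((n : K) + 1) • coeff (n + 1) H = coeff (n + 1) H * ((n : B) + 1) := by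
        rw [Algebra.smul_def, mul_comm]
        simp
      have h3 : (n : K) + 1 ≠ 0 := by exact_mod_cast Nat.succ_ne_zero n
      rw [← one_smul K (coeff (n + 1) H), ← inv_mul_cancel₀ h3, mul_smul, h2, h1]
      refine Subalgebra.smul_mem _ (Subalgebra.sum_mem _ fun ij hij => ?_) _
      rw [Finset.HasAntidiagonal.mem_antidiagonal] at hij
      refine mul_mem ?_ (ih _ (by omega))
      rw [← coeff_succ_X_mul]
      exact Algebra.subset_adjoin ⟨ij.1 + 1, rfl⟩

end PowerSums

/-! ### Power sum operators and power sum coordinates -/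

section PowerSumOperators

variable (K : Type*) [Field K]

/-- The commutative algebra generated by the operators `hOp K r`; it is isomorphic to the ring of
symmetric functions. -/
def HAlgebra : Type _ := Algebra.adjoin K (Set.range (hOp K))

instance : Ring (HAlgebra K) :=
  inferInstanceAs (Ring (Algebra.adjoin K (Set.range (hOp K))))

instance : CommRing (HAlgebra K) :=
  { (inferInstance : Ring (HAlgebra K)) with
    mul_comm := (Algebra.isMulCommutative_adjoin K (by
      rintro _ ⟨r, rfl⟩ _ ⟨s, rfl⟩
      exact hOp_mul_comm r s)).is_comm.comm }

instance : Algebra K (HAlgebra K) :=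
  inferInstanceAs (Algebra K (Algebra.adjoin K (Set.range (hOp K))))

/-- The action of the algebra generated by the operators `hOp K r`. -/
def toEnd : HAlgebra K →ₐ[K] Module.End K (YoungDiagram → K) :=
  (Algebra.adjoin K (Set.range (hOp K))).val

theorem toEnd_injective : Function.Injective (toEnd K) := Subtype.val_injective

theorem mem_range_toEnd {a : Module.End K (YoungDiagram → K)}
    (ha : a ∈ Algebra.adjoin K (Set.range (hOp K))) : ∃ b, toEnd K b = a := ⟨⟨a, ha⟩, rfl⟩

theorem hOp_mem (r : ℕ) : hOp K r ∈ Algebra.adjoin K (Set.range (hOp K)) :=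
  Algebra.subset_adjoin ⟨r, rfl⟩

/-- By recursion on `n`, from the relation `∑ (-1)^i e_i h_{n-i} = 0`. -/
theorem eOp_mem (n : ℕ) : eOp K n ∈ Algebra.adjoin K (Set.range (hOp K)) := by
  induction n using Nat.strong_induction_on with
  | _ n ih =>
    by_cases hn : n = 0
    · rw [hn, eOp_zero]
      exact one_mem _
    · have h := sum_eOp_mul_hOp (K := K) hn
      rw [Finset.sum_range_succ, Nat.sub_self, hOp_zero, mul_one, add_comm] at h
      have h1 : (-1 : K) ^ n • eOp K n ∈ Algebra.adjoin K (Set.range (hOp K)) := by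
        rw [eq_neg_of_add_eq_zero_left h]
        refine neg_mem (sum_mem fun i hi => Subalgebra.smul_mem _ (mul_mem ?_ (hOp_mem K _)) _)
        exact ih i (Finset.mem_range.1 hi)
      have h2 := Subalgebra.smul_mem _ h1 ((-1 : K) ^ n)
      rwa [smul_smul, ← mul_pow, neg_one_mul, neg_neg, one_pow, one_smul] at h2

/-- The generating function `∑ h_r t^r` of the operators `hOp K r`. -/
def hSeries : (HAlgebra K)⟦X⟧ :=
  PowerSeries.mk fun r => (mem_range_toEnd K (hOp_mem K r)).choose

/-- The generating function `∑ e_r t^r` of the operators `eOp K r`. -/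
def eSeries : (HAlgebra K)⟦X⟧ :=
  PowerSeries.mk fun r => (mem_range_toEnd K (eOp_mem K r)).choose

theorem toEnd_coeff_hSeries (r : ℕ) : toEnd K (PowerSeries.coeff r (hSeries K)) = hOp K r := by
  rw [hSeries, PowerSeries.coeff_mk]
  exact (mem_range_toEnd K (hOp_mem K r)).choose_spec

theorem toEnd_coeff_eSeries (r : ℕ) : toEnd K (PowerSeries.coeff r (eSeries K)) = eOp K r := by
  rw [eSeries, PowerSeries.coeff_mk]
  exact (mem_range_toEnd K (eOp_mem K r)).choose_spec

theorem coeff_zero_hSeries : PowerSeries.coeff 0 (hSeries K) = 1 :=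
  toEnd_injective K (by rw [toEnd_coeff_hSeries, hOp_zero, map_one])

theorem toEnd_coeff_evalNegHom_eSeries (r : ℕ) :
    toEnd K (PowerSeries.coeff r (PowerSeries.evalNegHom (eSeries K))) =
      (-1 : K) ^ r • eOp K r := by
  rw [coeff_evalNegHom, map_mul, toEnd_coeff_eSeries, Algebra.smul_def]
  simp only [map_pow, map_neg, map_one]

theorem evalNegHom_eSeries_mul_hSeries :
    PowerSeries.evalNegHom (eSeries K) * hSeries K = 1 := by
  ext1 n
  refine toEnd_injective K ?_
  have h : toEnd K (PowerSeries.coeff n (PowerSeries.evalNegHom (eSeries K) * hSeries K)) =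
      ∑ i ∈ Finset.range (n + 1), (-1 : K) ^ i • (eOp K i * hOp K (n - i)) := by
    rw [PowerSeries.coeff_mul, Finset.Nat.sum_antidiagonal_eq_sum_range_succ_mk, map_sum]
    refine Finset.sum_congr rfl fun i _ => ?_
    rw [map_mul, toEnd_coeff_hSeries, toEnd_coeff_evalNegHom_eSeries, smul_mul_assoc]
  rw [h, PowerSeries.coeff_one]
  by_cases hn : n = 0
  · subst hn
    simp [hOp_zero, eOp_zero]
  · rw [if_neg hn, sum_eOp_mul_hOp hn, map_zero]

/-- The operator of the power sum `p_n`, the adjoint of the multiplication by `p_n`, as given by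
`∑ p_{n+1} t^n = H'(t) / H(t)`. By convention it is zero for `n = 0`. -/
def pOp (n : ℕ) : HAlgebra K :=
  PowerSeries.coeff n (PowerSeries.X *
    (PowerSeries.derivative (HAlgebra K) (hSeries K) * PowerSeries.evalNegHom (eSeries K)))

theorem pOp_zero : pOp K 0 = 0 := PowerSeries.coeff_zero_X_mul _

theorem pOp_mem_lowering (n : ℕ) : toEnd K (pOp K n) ∈ lowering K n := by
  cases n with
  | zero => rw [pOp_zero, map_zero]; exact zero_mem _
  | succ n =>
    rw [pOp, PowerSeries.coeff_succ_X_mul, PowerSeries.coeff_mul, map_sum]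
    refine sum_mem fun ij hij => ?_
    rw [Finset.HasAntidiagonal.mem_antidiagonal] at hij
    have h1 : (ij.1 + 1) • hOp K (ij.1 + 1) ∈ lowering K (ij.1 + 1) :=
      nsmul_mem (stripOp_mem_lowering _ _) _
    have h2 : (-1 : K) ^ ij.2 • eOp K ij.2 ∈ lowering K ij.2 :=
      Submodule.smul_mem _ _ (stripOp_mem_lowering _ _)
    have h3 := mul_mem_lowering h1 h2
    rw [show ij.1 + 1 + ij.2 = n + 1 by omega] at h3
    rwa [map_mul, toEnd_coeff_evalNegHom_eSeries, PowerSeries.coeff_derivative, ← Nat.cast_add_one,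
      ← nsmul_eq_mul', map_nsmul, toEnd_coeff_hSeries]

/-- The power sum operator `p_{s_1} p_{s_2} ⋯` of a multiset `s`, followed by taking the value at the
empty diagram. These are the coordinates with respect to which the condition of being doubly
symmetric becomes diagonal. -/
def powerSumCoord (s : Multiset ℕ) : (YoungDiagram → K) →ₗ[K] K :=
  LinearMap.proj ⊥ ∘ₗ toEnd K (s.map (pOp K)).prod

variable {K}

theorem powerSumCoord_apply (s : Multiset ℕ) (g : YoungDiagram → K) :
    powerSumCoord K s g = toEnd K (s.map (pOp K)).prod g ⊥ := rfl

theorem powerSumCoord_pOp (s : Multiset ℕ) (n : ℕ) (g : YoungDiagram → K) :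
    powerSumCoord K s (toEnd K (pOp K n) g) = powerSumCoord K (n ::ₘ s) g := by
  rw [powerSumCoord_apply, powerSumCoord_apply, Multiset.map_cons, Multiset.prod_cons, mul_comm,
    map_mul, Module.End.mul_apply]

theorem prod_pOp_mem_lowering (s : Multiset ℕ) :
    toEnd K (s.map (pOp K)).prod ∈ lowering K s.sum := by
  induction s using Multiset.induction with
  | empty =>
    rw [Multiset.map_zero, Multiset.prod_zero, map_one]
    exact one_mem_lowering
  | cons n s ih =>
    rw [Multiset.map_cons, Multiset.prod_cons, Multiset.sum_cons, map_mul]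
    exact mul_mem_lowering (pOp_mem_lowering K n) ih

/-- On functions supported in degree `n`, only the power sum coordinates of partitions of `n` are
not zero. -/
theorem powerSumCoord_eq_zero {n : ℕ} {g : YoungDiagram → K} (hg : ∀ μ, μ.card ≠ n → g μ = 0)
    {s : Multiset ℕ} (hs : ∀ p : n.Partition, p.parts = s → powerSumCoord K s g = 0) :
    powerSumCoord K s g = 0 := by
  by_cases h0 : 0 ∈ s
  · obtain ⟨t, rfl⟩ := Multiset.exists_cons_of_mem h0
    rw [powerSumCoord_apply, Multiset.map_cons, Multiset.prod_cons, pOp_zero, zero_mul, map_zero]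
    rfl
  · by_cases hn : s.sum = n
    · exact hs ⟨s, fun {i} hi => Nat.pos_of_ne_zero fun h => h0 (h ▸ hi), hn⟩ rfl
    · refine mem_lowering.1 (prod_pOp_mem_lowering s) g ⊥ fun μ hμ => hg μ ?_
      rw [hμ, card_eq_zero_iff.2 rfl, zero_add]
      exact hn

variable (K) in
/-- The functions `g` of degree `n` (standing for `∑ g μ • S_μ`) with `h_r^⊥ g = e_r^⊥ g` for
all `r`. -/
def stripSymmetric (n : ℕ) : Submodule K (YoungDiagram → K) where
  carrier := {g | (∀ μ, μ.card ≠ n → g μ = 0) ∧ ∀ r, hOp K r g = eOp K r g}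
  zero_mem' := ⟨fun _ _ => rfl, fun r => by rw [map_zero, map_zero]⟩
  add_mem' := fun ha hb => ⟨fun μ hμ => by rw [Pi.add_apply, ha.1 μ hμ, hb.1 μ hμ, add_zero],
    fun r => by rw [map_add, map_add, ha.2, hb.2]⟩
  smul_mem' := fun c a ha => ⟨fun μ hμ => by rw [Pi.smul_apply, ha.1 μ hμ, smul_zero],
    fun r => by rw [map_smul, map_smul, ha.2]⟩

section CharZero

variable [CharZero K]

/-- The power sum coordinates separate the functions on Young diagrams, as the `h_r` do. -/
theorem eq_zero_of_powerSumCoord {g : YoungDiagram → K} (H : ∀ s, powerSumCoord K s g = 0) :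
    g = 0 := by
  refine eq_zero_of_prod_hOp_apply_bot fun l => ?_
  have h1 : ∀ a ∈ Algebra.adjoin K (Set.range (pOp K)), toEnd K a g ⊥ = 0 := by
    intro a ha
    rw [← Subalgebra.mem_toSubmodule, Algebra.adjoin_eq_span] at ha
    induction ha using Submodule.span_induction with
    | mem a ha =>
      obtain ⟨s, rfl⟩ : ∃ s : Multiset ℕ, (s.map (pOp K)).prod = a := by
        induction ha using Submonoid.closure_induction with
        | mem a ha =>
          obtain ⟨n, rfl⟩ := ha
          exact ⟨{n}, by simp⟩
        | one => exact ⟨0, by simp⟩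
        | mul a b _ _ ha hb =>
          obtain ⟨s, rfl⟩ := ha
          obtain ⟨t, rfl⟩ := hb
          exact ⟨s + t, by simp⟩
      exact H s
    | zero => rw [map_zero]; rfl
    | add a b _ _ ha hb =>
      rw [map_add, LinearMap.add_apply, Pi.add_apply, ha, hb, add_zero]
    | smul c a _ ha =>
      rw [map_smul, LinearMap.smul_apply, Pi.smul_apply, ha, smul_zero]
  have h2 : toEnd K (l.map fun r => PowerSeries.coeff r (hSeries K)).prod =
      (l.map (hOp K)).prod := by
    rw [map_list_prod, List.map_map]
    exact congrArg (fun f => (l.map f).prod) (funext fun r => toEnd_coeff_hSeries K r)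
  rw [← h2]
  refine h1 _ (list_prod_mem fun a ha => ?_)
  obtain ⟨r, -, rfl⟩ := List.mem_map.1 ha
  exact coeff_mem_adjoin_powerSums K (coeff_zero_hSeries K) (evalNegHom_eSeries_mul_hSeries K) r

/-- The ideal of the operators that annihilate `g`. -/
def annihilatorIdeal (g : YoungDiagram → K) : Ideal (HAlgebra K) where
  carrier := {a | toEnd K a g = 0}
  zero_mem' := by
    change toEnd K 0 g = 0
    rw [map_zero, LinearMap.zero_apply]
  add_mem' {a b} ha hb := by
    change toEnd K (a + b) g = 0
    rw [map_add, LinearMap.add_apply, show toEnd K a g = 0 from ha,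
      show toEnd K b g = 0 from hb, add_zero]
  smul_mem' c a ha := by
    change toEnd K (c * a) g = 0
    rw [map_mul, Module.End.mul_apply, show toEnd K a g = 0 from ha, map_zero]

/-- The even power sums detect the difference between horizontal and vertical strips. -/
theorem hOp_eq_eOp_iff (g : YoungDiagram → K) :
    (∀ r, hOp K r g = eOp K r g) ↔ ∀ i, toEnd K (pOp K (2 * i + 2)) g = 0 := by
  have h := forall_coeff_sub_mem_iff K (coeff_zero_hSeries K) (evalNegHom_eSeries_mul_hSeries K)
    (annihilatorIdeal g)
  have h1 : ∀ r, PowerSeries.coeff r (hSeries K) - PowerSeries.coeff r (eSeries K) ∈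
      annihilatorIdeal g ↔ hOp K r g = eOp K r g := by
    intro r
    rw [← sub_eq_zero, ← LinearMap.sub_apply, ← toEnd_coeff_hSeries, ← toEnd_coeff_eSeries,
      ← map_sub (toEnd K)]
    rfl
  have h2 : ∀ i, PowerSeries.coeff (2 * i + 1) (PowerSeries.derivative (HAlgebra K) (hSeries K) *
      PowerSeries.evalNegHom (eSeries K)) ∈ annihilatorIdeal g ↔
      toEnd K (pOp K (2 * i + 2)) g = 0 := by
    intro i
    rw [← PowerSeries.coeff_succ_X_mul]
    rfl
  simpa only [h1, h2] using h

theorem mem_odds_iff {n : ℕ} {p : n.Partition} :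
    p ∈ Nat.Partition.odds n ↔ ∀ i ∈ p.parts, ¬ Even i := by
  simp [Nat.Partition.odds, Nat.Partition.restricted]

theorem powerSumCoord_eq_zero_of_even {n : ℕ} {g : YoungDiagram → K} (hg : g ∈ stripSymmetric K n)
    {s : Multiset ℕ} {i : ℕ} (hi : i ∈ s) (heven : Even i) : powerSumCoord K s g = 0 := by
  obtain ⟨t, rfl⟩ := Multiset.exists_cons_of_mem hi
  rw [← powerSumCoord_pOp]
  obtain ⟨j, rfl⟩ := heven
  have h : toEnd K (pOp K (j + j)) g = 0 := by
    cases j with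
    | zero => rw [add_zero, pOp_zero, map_zero, LinearMap.zero_apply]
    | succ j =>
      rw [show j + 1 + (j + 1) = 2 * j + 2 by omega]
      exact (hOp_eq_eOp_iff g).1 hg.2 j
  rw [h, map_zero]

/-- In degree `n`, the power sum coordinates can be prescribed arbitrarily. -/
theorem exists_powerSumCoord_eq (n : ℕ) (f : n.Partition → K) :
    ∃ g : YoungDiagram → K, (∀ μ, μ.card ≠ n → g μ = 0) ∧
      ∀ p : n.Partition, powerSumCoord K p.parts g = f p := by
  classical
  let ext : (diagrams n → K) →ₗ[K] (YoungDiagram → K) :=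
    { toFun := fun u μ => if h : μ ∈ diagrams n then u ⟨μ, h⟩ else 0
      map_add' := fun u v => by
        funext μ
        by_cases h : μ ∈ diagrams n
        · simp only [dif_pos h, Pi.add_apply]
        · simp only [dif_neg h, Pi.add_apply, add_zero]
      map_smul' := fun c u => by
        funext μ
        by_cases h : μ ∈ diagrams n
        · simp only [dif_pos h, Pi.smul_apply, RingHom.id_apply]
        · simp only [dif_neg h, Pi.smul_apply, smul_zero] }
  have hext : ∀ u μ, μ.card ≠ n → ext u μ = 0 := fun u μ hμ =>
    dif_neg fun h => hμ (mem_diagrams.1 h)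
  let Φ : (diagrams n → K) →ₗ[K] (n.Partition → K) :=
    LinearMap.pi fun p => powerSumCoord K p.parts ∘ₗ ext
  have hinj : Function.Injective Φ := by
    rw [← LinearMap.ker_eq_bot, LinearMap.ker_eq_bot']
    intro u hu
    have h0 : ext u = 0 := eq_zero_of_powerSumCoord fun s =>
      powerSumCoord_eq_zero (hext u) fun p hp => by
        rw [← hp]
        exact congrFun hu p
    funext μ
    have h1 := congrFun h0 μ.1
    have h2 : ext u μ.1 = u μ := dif_pos μ.2
    rw [← h2, h1, Pi.zero_apply, Pi.zero_apply]
  -- There are as many partitions of `n` as Young diagrams with `n` cells.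
  have hsurj : Function.Surjective Φ := by
    rwa [← LinearMap.injective_iff_surjective_of_finrank_eq_finrank]
    rw [Module.finrank_fintype_fun_eq_card, Module.finrank_fintype_fun_eq_card, Fintype.card_coe,
      card_diagrams]
  obtain ⟨u, hu⟩ := hsurj f
  exact ⟨ext u, hext u, fun p => congrFun hu p⟩

variable (K) in
/-- The power sum coordinates of the partitions into odd parts, on `stripSymmetric K n`. -/
def oddCoord (n : ℕ) : stripSymmetric K n →ₗ[K] (Nat.Partition.odds n → K) :=
  LinearMap.pi fun p => powerSumCoord K p.1.parts ∘ₗ (stripSymmetric K n).subtype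

theorem oddCoord_bijective (n : ℕ) : Function.Bijective (oddCoord K n) := by
  classical
  constructor
  · rw [← LinearMap.ker_eq_bot, LinearMap.ker_eq_bot']
    rintro ⟨g, hg⟩ h
    refine Subtype.ext (eq_zero_of_powerSumCoord fun s => powerSumCoord_eq_zero hg.1 fun p hp => ?_)
    subst hp
    by_cases hodd : p ∈ Nat.Partition.odds n
    · exact congrFun h ⟨p, hodd⟩
    · rw [mem_odds_iff] at hodd
      push Not at hodd
      obtain ⟨i, hi, heven⟩ := hodd
      exact powerSumCoord_eq_zero_of_even hg hi heven
  · intro f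
    obtain ⟨g, hg, hgf⟩ := exists_powerSumCoord_eq n fun p : n.Partition =>
      if h : p ∈ Nat.Partition.odds n then f ⟨p, h⟩ else 0
    have hmem : g ∈ stripSymmetric K n := by
      refine ⟨hg, (hOp_eq_eOp_iff g).2 fun i => eq_zero_of_powerSumCoord fun s => ?_⟩
      rw [powerSumCoord_pOp]
      refine powerSumCoord_eq_zero hg fun p hp => ?_
      rw [← hp, hgf, dif_neg]
      rw [mem_odds_iff, hp]
      exact fun h => h (2 * i + 2) (Multiset.mem_cons_self _ _) ⟨i + 1, by omega⟩
    refine ⟨⟨g, hmem⟩, funext fun p => ?_⟩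
    have := hgf p.1
    rw [dif_pos p.2] at this
    exact this

end CharZero

end PowerSumOperators

/-! ### Removing the largest symbol from a tableau -/

section Tableaux

/-- The strips that may be filled with one symbol: vertical strips for a primed symbol (`q` holds)
and horizontal strips for an unprimed one. -/
def IsStrip (q : Prop) (μ κ : YoungDiagram) : Prop :=
  (q → IsVerticalStrip μ κ) ∧ (¬ q → IsHorizontalStrip μ κ)

/-- The tableaux of shape `μ` with entries in `{0, …, N - 1}`, extended by `0` outside `μ`, in which
each `v` is a primed symbol if `p v` holds and an unprimed one otherwise, and in which each `v < N`
occurs `d v` times. Both semistandard and hook tableaux are of this kind. -/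
def signedTableaux (p : ℕ → Prop) (d : ℕ → ℕ) (N : ℕ) (μ : YoungDiagram) : Set (ℕ × ℕ → ℕ) :=
  {T | (∀ c ∉ μ, T c = 0) ∧ (∀ c ∈ μ, T c < N) ∧
    (∀ a ∈ μ, ∀ b ∈ μ, a.1 = b.1 → a.2 < b.2 → T a ≤ T b ∧ (T a = T b → ¬ p (T a))) ∧
    (∀ a ∈ μ, ∀ b ∈ μ, a.2 = b.2 → a.1 < b.1 → T a ≤ T b ∧ (T a = T b → p (T a))) ∧
    ∀ v < N, (μ.cells.filter fun c => T c = v).card = d v}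

theorem mem_signedTableaux {p : ℕ → Prop} {d : ℕ → ℕ} {N : ℕ} {μ : YoungDiagram}
    {T : ℕ × ℕ → ℕ} : T ∈ signedTableaux p d N μ ↔ (∀ c ∉ μ, T c = 0) ∧ (∀ c ∈ μ, T c < N) ∧
    (∀ a ∈ μ, ∀ b ∈ μ, a.1 = b.1 → a.2 < b.2 → T a ≤ T b ∧ (T a = T b → ¬ p (T a))) ∧
    (∀ a ∈ μ, ∀ b ∈ μ, a.2 = b.2 → a.1 < b.1 → T a ≤ T b ∧ (T a = T b → p (T a))) ∧
    ∀ v < N, (μ.cells.filter fun c => T c = v).card = d v := Iff.rfl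

theorem finite_signedTableaux (p : ℕ → Prop) (d : ℕ → ℕ) (N : ℕ) (μ : YoungDiagram) :
    (signedTableaux p d N μ).Finite := by
  let F : signedTableaux p d N μ → (μ.cells → Fin N) := fun T c => ⟨T.1 c.1, T.2.2.1 c.1 c.2⟩
  refine Set.finite_coe_iff.1 (Finite.of_injective F fun T T' h => Subtype.ext (funext fun c => ?_))
  by_cases hc : c ∈ μ
  · exact congrArg Fin.val (congrFun h ⟨c, hc⟩)
  · rw [T.2.1 c hc, T'.2.1 c hc]

theorem card_of_mem_signedTableaux {p : ℕ → Prop} {d : ℕ → ℕ} {N : ℕ} {μ : YoungDiagram}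
    {T : ℕ × ℕ → ℕ} (hT : T ∈ signedTableaux p d N μ) : μ.card = ∑ v ∈ Finset.range N, d v := by
  obtain ⟨-, hN, -, -, hd⟩ := hT
  rw [YoungDiagram.card, Finset.card_eq_sum_card_fiberwise (f := T) (t := Finset.range N)]
  · exact Finset.sum_congr rfl fun v hv => hd v (Finset.mem_range.1 hv)
  · exact fun c hc => Finset.mem_coe.2 (Finset.mem_range.2 (hN c hc))

open Classical in
/-- The cells of `μ` with no entry `≥ N` to the upper left. For a tableau `T` these are the cells with
an entry `< N`. -/
def cellsBelow (μ : YoungDiagram) (T : ℕ × ℕ → ℕ) (N : ℕ) : YoungDiagram where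
  cells := μ.cells.filter fun c => ∀ c' ≤ c, T c' < N
  isLowerSet := fun c c' hle hc => by
    simp only [Finset.coe_filter, Set.mem_ofPred_eq] at hc ⊢
    exact ⟨μ.isLowerSet hle hc.1, fun c'' h => hc.2 c'' (h.trans hle)⟩

theorem mem_cellsBelow {p : ℕ → Prop} {d : ℕ → ℕ} {M : ℕ} {μ : YoungDiagram}
    {T : ℕ × ℕ → ℕ} (hT : T ∈ signedTableaux p d M μ) (N : ℕ) (c : ℕ × ℕ) :
    c ∈ cellsBelow μ T N ↔ c ∈ μ ∧ T c < N := by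
  classical
  obtain ⟨-, -, hrow, hcol, -⟩ := hT
  rw [← YoungDiagram.mem_cells, cellsBelow, Finset.mem_filter, YoungDiagram.mem_cells]
  refine and_congr_right fun hc => ⟨fun h => h c le_rfl, fun h c' hle => ?_⟩
  have h1 : (c'.1, c.2) ∈ μ := μ.up_left_mem hle.1 le_rfl hc
  have h2 : c' ∈ μ := μ.up_left_mem le_rfl hle.2 h1
  have h3 : T c' ≤ T (c'.1, c.2) := by
    obtain h | h := hle.2.lt_or_eq
    · exact (hrow c' h2 _ h1 rfl h).1
    · rw [← h]
  have h4 : T (c'.1, c.2) ≤ T c := by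
    obtain h | h := hle.1.lt_or_eq
    · exact (hcol _ h1 c hc rfl h).1
    · rw [h]
  omega

theorem isStrip_of_mem_signedTableaux {p : ℕ → Prop} {d : ℕ → ℕ} {N : ℕ} {μ κ : YoungDiagram}
    {T : ℕ × ℕ → ℕ} (hT : T ∈ signedTableaux p d (N + 1) μ)
    (hκ : ∀ c, c ∈ κ ↔ c ∈ μ ∧ T c < N) : IsStrip (p N) μ κ := by
  obtain ⟨-, hN, hrow, hcol, -⟩ := hT
  have hle : ∀ i, κ.rowLen i ≤ μ.rowLen i := fun i => le_of_forall_lt fun j hj =>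
    YoungDiagram.mem_iff_lt_rowLen.1 ((hκ _).1 (YoungDiagram.mem_iff_lt_rowLen.2 hj)).1
  have hval : ∀ i j, j < μ.rowLen i → κ.rowLen i ≤ j → (i, j) ∈ μ ∧ T (i, j) = N := by
    intro i j h1 h2
    have h3 : (i, j) ∈ μ := YoungDiagram.mem_iff_lt_rowLen.2 h1
    refine ⟨h3, ?_⟩
    have h4 := hN _ h3
    by_contra h5
    have h6 := YoungDiagram.mem_iff_lt_rowLen.1 ((hκ _).2 ⟨h3, by omega⟩)
    omega
  refine ⟨fun hp i => ⟨hle i, ?_⟩, fun hp i => ⟨hle i, ?_⟩⟩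
  · by_contra hlt
    obtain ⟨h1, h2⟩ := hval i (κ.rowLen i) (by omega) le_rfl
    obtain ⟨h3, h4⟩ := hval i (κ.rowLen i + 1) (by omega) (by omega)
    exact (hrow _ h1 _ h3 rfl (Nat.lt_succ_self _)).2 (h2.trans h4.symm) (by rwa [h2])
  · by_contra hlt
    have h0 := μ.rowLen_anti _ _ (Nat.le_succ i)
    have h0' := κ.rowLen_anti _ _ (Nat.le_succ i)
    simp only [Nat.succ_eq_add_one] at h0 h0'
    obtain ⟨h1, h2⟩ := hval i (κ.rowLen i) (by omega) le_rfl
    obtain ⟨h3, h4⟩ := hval (i + 1) (κ.rowLen i) (by omega) (by omega)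
    have h5 := (hcol _ h1 _ h3 rfl (Nat.lt_succ_self _)).2 (h2.trans h4.symm)
    rw [h2] at h5
    exact hp h5

theorem restrict_mem_signedTableaux {p : ℕ → Prop} {d : ℕ → ℕ} {N : ℕ} {μ κ : YoungDiagram}
    {T : ℕ × ℕ → ℕ} (hT : T ∈ signedTableaux p d (N + 1) μ)
    (hκ : ∀ c, c ∈ κ ↔ c ∈ μ ∧ T c < N) :
    (fun c => if c ∈ κ then T c else 0) ∈ signedTableaux p d N κ := by
  obtain ⟨-, hN, hrow, hcol, hd⟩ := hT
  refine ⟨fun c hc => if_neg hc, fun c hc => ?_, fun a ha b hb h1 h2 => ?_,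
    fun a ha b hb h1 h2 => ?_, fun v hv => ?_⟩
  · simp only [if_pos hc]
    exact ((hκ c).1 hc).2
  · simp only [if_pos ha, if_pos hb]
    exact hrow a ((hκ a).1 ha).1 b ((hκ b).1 hb).1 h1 h2
  · simp only [if_pos ha, if_pos hb]
    exact hcol a ((hκ a).1 ha).1 b ((hκ b).1 hb).1 h1 h2
  · rw [← hd v (hv.trans (Nat.lt_succ_self N))]
    congr 1
    ext c
    simp only [Finset.mem_filter, YoungDiagram.mem_cells]
    constructor
    · rintro ⟨h1, h2⟩
      rw [if_pos h1] at h2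
      exact ⟨((hκ c).1 h1).1, h2⟩
    · rintro ⟨h1, h2⟩
      have h3 : c ∈ κ := (hκ c).2 ⟨h1, h2.trans_lt hv⟩
      exact ⟨h3, by rw [if_pos h3, h2]⟩

theorem extend_mem_signedTableaux {p : ℕ → Prop} {d : ℕ → ℕ} {N : ℕ} {μ κ : YoungDiagram}
    {T : ℕ × ℕ → ℕ} (hT : T ∈ signedTableaux p d N κ) (hle : κ ≤ μ)
    (hstrip : IsStrip (p N) μ κ) (hcard : μ.card = κ.card + d N) :
    (fun c => if c ∈ κ then T c else if c ∈ μ then N else 0) ∈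
      signedTableaux p d (N + 1) μ := by
  obtain ⟨-, hN, hrow, hcol, hd⟩ := hT
  refine ⟨fun c hc => ?_, fun c hc => ?_, ?_, ?_, fun v hv => ?_⟩
  · simp only [if_neg fun h => hc (hle h), if_neg hc]
  · beta_reduce
    split_ifs with h
    · exact (hN c h).trans (Nat.lt_succ_self N)
    · exact Nat.lt_succ_self N
  · rintro ⟨i, j⟩ ha ⟨i', j'⟩ hb h1 h2
    obtain rfl : i = i' := h1
    by_cases hb' : (i, j') ∈ κ
    · have ha' : (i, j) ∈ κ := κ.up_left_mem le_rfl (le_of_lt h2) hb'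
      simp only [if_pos ha', if_pos hb']
      exact hrow _ ha' _ hb' rfl h2
    · by_cases ha' : (i, j) ∈ κ
      · simp only [if_pos ha', if_neg hb', if_pos hb]
        have := hN _ ha'
        exact ⟨by omega, fun h => by omega⟩
      · simp only [if_neg ha', if_neg hb', if_pos ha, if_pos hb, le_refl, true_and,
          forall_true_left]
        intro hp
        rw [YoungDiagram.mem_iff_lt_rowLen] at ha ha' hb hb'
        have h3 := (hstrip.1 hp i).2
        simp only at h2
        omega
  · rintro ⟨i, j⟩ ha ⟨i', j'⟩ hb h1 h2
    obtain rfl : j = j' := h1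
    by_cases hb' : (i', j) ∈ κ
    · have ha' : (i, j) ∈ κ := κ.up_left_mem (le_of_lt h2) le_rfl hb'
      simp only [if_pos ha', if_pos hb']
      exact hcol _ ha' _ hb' rfl h2
    · by_cases ha' : (i, j) ∈ κ
      · simp only [if_pos ha', if_neg hb', if_pos hb]
        have := hN _ ha'
        exact ⟨by omega, fun h => by omega⟩
      · simp only [if_neg ha', if_neg hb', if_pos ha, if_pos hb, le_refl, true_and,
          forall_true_left]
        by_contra hp
        rw [YoungDiagram.mem_iff_lt_rowLen] at ha ha' hb hb'
        have h3 := (hstrip.2 hp i).2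
        have h4 := μ.rowLen_anti (i + 1) i' h2
        omega
  · obtain h | rfl := (Nat.lt_succ_iff.1 hv).lt_or_eq
    · rw [← hd v h]
      congr 1
      ext c
      simp only [Finset.mem_filter, YoungDiagram.mem_cells]
      constructor
      · rintro ⟨h1, h2⟩
        by_cases hc : c ∈ κ
        · rw [if_pos hc] at h2
          exact ⟨hc, h2⟩
        · rw [if_neg hc, if_pos h1] at h2
          omega
      · rintro ⟨h1, h2⟩
        exact ⟨hle h1, by rw [if_pos h1, h2]⟩
    · have h1 : (μ.cells.filter fun c => (if c ∈ κ then T c else if c ∈ μ then v else 0) = v) =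
          μ.cells \ κ.cells := by
        ext c
        simp only [Finset.mem_filter, Finset.mem_sdiff, YoungDiagram.mem_cells]
        refine and_congr_right fun hc => ?_
        by_cases hc' : c ∈ κ
        · have := hN c hc'
          rw [if_pos hc']
          simp only [hc', not_true_eq_false, iff_false]
          omega
        · simp [hc', hc]
      rw [h1, Finset.card_sdiff_of_subset (YoungDiagram.cells_subset_iff.2 hle)]
      simp only [YoungDiagram.card] at hcard
      omega

theorem le_of_isStrip {q : Prop} {μ κ : YoungDiagram} (h : IsStrip q μ κ) : κ ≤ μ := by
  have hle : ∀ i, κ.rowLen i ≤ μ.rowLen i := fun i => by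
    by_cases hq : q
    · exact (h.1 hq i).1
    · exact (h.2 hq i).1
  rintro ⟨i, j⟩ hij
  change (i, j) ∈ κ at hij
  rw [YoungDiagram.mem_iff_lt_rowLen] at hij ⊢
  exact hij.trans_le (hle i)

theorem card_cellsBelow {p : ℕ → Prop} {d : ℕ → ℕ} {N D : ℕ} {μ : YoungDiagram}
    {T : ℕ × ℕ → ℕ} (hT : T ∈ signedTableaux p d (N + 1) μ) (hμ : μ.card = D + d N) :
    (cellsBelow μ T N).card = D := by
  have h1 := hT.2.2.2.2 N (Nat.lt_succ_self N)
  have h2 : (cellsBelow μ T N).cells = μ.cells.filter fun c => ¬ T c = N := by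
    ext c
    rw [YoungDiagram.mem_cells, mem_cellsBelow hT, Finset.mem_filter, YoungDiagram.mem_cells]
    refine and_congr_right fun hc => ?_
    have := hT.2.1 c hc
    omega
  have h3 := Finset.card_filter_add_card_filter_not (s := μ.cells) (fun c => T c = N)
  rw [YoungDiagram.card, h2]
  simp only [YoungDiagram.card] at hμ
  omega

open Classical in
/-- Removing the largest symbol from the tableaux of shape `μ`. -/
theorem ncard_signedTableaux_succ (p : ℕ → Prop) (d : ℕ → ℕ) (N : ℕ) {D : ℕ} {μ : YoungDiagram}
    (hμ : μ.card = D + d N) :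
    (signedTableaux p d (N + 1) μ).ncard =
      ∑ κ ∈ diagrams D, if IsStrip (p N) μ κ then (signedTableaux p d N κ).ncard else 0 := by
  rw [Set.ncard_eq_toFinset_card _ (finite_signedTableaux p d (N + 1) μ),
    Finset.card_eq_sum_card_fiberwise (f := fun T => cellsBelow μ T N) (t := diagrams D)]
  · refine Finset.sum_congr rfl fun κ hκ => ?_
    rw [mem_diagrams] at hκ
    split_ifs with hstrip
    · have hle := le_of_isStrip hstrip
      rw [Set.ncard_eq_toFinset_card _ (finite_signedTableaux p d N κ)]
      have hbelow : ∀ T ∈ signedTableaux p d N κ,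
          cellsBelow μ (fun c => if c ∈ κ then T c else if c ∈ μ then N else 0) N = κ := by
        intro T hT
        ext c
        rw [YoungDiagram.mem_cells, YoungDiagram.mem_cells,
          mem_cellsBelow (extend_mem_signedTableaux hT hle hstrip (by rw [hμ, hκ]))]
        constructor
        · rintro ⟨h1, h2⟩
          by_contra h3
          rw [if_neg h3, if_pos h1] at h2
          exact lt_irrefl _ h2
        · intro h
          exact ⟨hle h, by rw [if_pos h]; exact hT.2.1 c h⟩
      refine Finset.card_nbij' (fun T c => if c ∈ κ then T c else 0)
        (fun T c => if c ∈ κ then T c else if c ∈ μ then N else 0) ?_ ?_ ?_ ?_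
      · intro T hT
        simp only [Finset.coe_filter, Set.Finite.mem_toFinset, Set.mem_ofPred_eq] at hT
        rw [Finset.mem_coe, Set.Finite.mem_toFinset]
        refine restrict_mem_signedTableaux hT.1 fun c => ?_
        rw [← mem_cellsBelow hT.1, hT.2]
      · intro T hT
        rw [Finset.mem_coe, Set.Finite.mem_toFinset] at hT
        simp only [Finset.coe_filter, Set.Finite.mem_toFinset, Set.mem_ofPred_eq]
        exact ⟨extend_mem_signedTableaux hT hle hstrip (by rw [hμ, hκ]), hbelow T hT⟩
      · intro T hT
        simp only [Finset.coe_filter, Set.Finite.mem_toFinset, Set.mem_ofPred_eq] at hT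
        funext c
        by_cases hc : c ∈ κ
        · simp only [if_pos hc]
        · simp only [if_neg hc]
          split_ifs with hc'
          · have h1 := hT.1.2.1 c hc'
            have h2 := mem_cellsBelow hT.1 N c
            rw [hT.2] at h2
            have h3 : ¬ T c < N := fun h => hc (h2.2 ⟨hc', h⟩)
            omega
          · exact (hT.1.1 c hc').symm
      · intro T hT
        rw [Finset.mem_coe, Set.Finite.mem_toFinset] at hT
        funext c
        by_cases hc : c ∈ κ
        · simp only [if_pos hc]
        · simp only [if_neg hc]
          exact (hT.1 c hc).symm
    · rw [Finset.card_eq_zero, Finset.filter_eq_empty_iff]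
      intro T hT hTκ
      rw [Set.Finite.mem_toFinset] at hT
      exact hstrip (isStrip_of_mem_signedTableaux hT fun c => by rw [← mem_cellsBelow hT, hTκ])
  · intro T hT
    rw [Finset.mem_coe, Set.Finite.mem_toFinset] at hT
    exact mem_diagrams.2 (card_cellsBelow hT hμ)

variable {K : Type*} [Field K]

variable (K) in
/-- The operator that removes in turn the strips that are filled with `N - 1, …, 1, 0` in the
tableaux of content `d`. -/
def wordOp (p : ℕ → Prop) (d : ℕ → ℕ) (N : ℕ) : Module.End K (YoungDiagram → K) :=
  ((List.range N).map fun i => stripOp K (IsStrip (p i)) (d i)).prod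

/-- The pairing of a function `g` with the numbers of tableaux of content `d`, expressed by strip
operators. -/
theorem sum_ncard_signedTableaux_mul (p : ℕ → Prop) (d : ℕ → ℕ) (N : ℕ) (g : YoungDiagram → K) :
    ∑ μ ∈ diagrams (∑ i ∈ Finset.range N, d i), ((signedTableaux p d N μ).ncard : K) * g μ =
      wordOp K p d N g ⊥ := by
  classical
  induction N generalizing g with
  | zero =>
    have h1 : diagrams 0 = {⊥} := by
      ext μ
      rw [mem_diagrams, Finset.mem_singleton, card_eq_zero_iff]
    have h2 : signedTableaux p d 0 ⊥ = {fun _ => 0} := by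
      ext T
      rw [Set.mem_singleton_iff, mem_signedTableaux]
      constructor
      · exact fun h => funext fun c => h.1 c (YoungDiagram.notMem_bot c)
      · rintro rfl
        simp
    rw [Finset.range_zero, Finset.sum_empty, h1, Finset.sum_singleton, h2, Set.ncard_singleton]
    simp [wordOp]
  | succ N ih =>
    have hop : wordOp K p d (N + 1) g = wordOp K p d N (stripOp K (IsStrip (p N)) (d N) g) := by
      simp [wordOp, List.range_succ]
    rw [hop, ← ih, Finset.sum_range_succ]
    have h1 : ∀ μ ∈ diagrams (∑ i ∈ Finset.range N, d i + d N),
        ((signedTableaux p d (N + 1) μ).ncard : K) * g μ =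
        ∑ κ ∈ diagrams (∑ i ∈ Finset.range N, d i), ((signedTableaux p d N κ).ncard : K) *
          if IsStrip (p N) μ κ then g μ else 0 := by
      intro μ hμ
      rw [ncard_signedTableaux_succ p d N (mem_diagrams.1 hμ), Nat.cast_sum, Finset.sum_mul]
      refine Finset.sum_congr rfl fun κ _ => ?_
      split_ifs <;> simp
    rw [Finset.sum_congr rfl h1, Finset.sum_comm]
    refine Finset.sum_congr rfl fun κ hκ => ?_
    rw [← Finset.mul_sum, stripOp_apply, mem_diagrams.1 hκ]

theorem wordOp_congr {p p' : ℕ → Prop} {d d' : ℕ → ℕ} {N : ℕ} (hp : ∀ i < N, p i ↔ p' i)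
    (hd : ∀ i < N, d i = d' i) : wordOp K p d N = wordOp K p' d' N := by
  rw [wordOp, wordOp]
  congr 1
  refine List.map_congr_left fun i hi => ?_
  rw [List.mem_range] at hi
  rw [hd i hi, propext (hp i hi)]

theorem finsupp_sum_mul_ncard (p : ℕ → Prop) (d : ℕ → ℕ) (N : ℕ) (m : YoungDiagram →₀ K) :
    m.sum (fun μ a => a * ((signedTableaux p d N μ).ncard : K)) = wordOp K p d N m ⊥ := by
  classical
  rw [← sum_ncard_signedTableaux_mul, Finsupp.sum]
  trans ∑ μ ∈ m.support ∪ diagrams (∑ i ∈ Finset.range N, d i),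
    ((signedTableaux p d N μ).ncard : K) * m μ
  · rw [← Finset.sum_subset Finset.subset_union_left]
    · exact Finset.sum_congr rfl fun μ _ => mul_comm _ _
    · intro μ _ hμ
      rw [Finsupp.notMem_support_iff.1 hμ, mul_zero]
  · refine (Finset.sum_subset Finset.subset_union_right fun μ _ hμ => ?_).symm
    have h : signedTableaux p d N μ = ∅ := Set.eq_empty_of_forall_notMem fun T hT =>
      hμ (mem_diagrams.2 (card_of_mem_signedTableaux hT))
    rw [h, Set.ncard_empty, Nat.cast_zero, zero_mul]

theorem content_apply {μ : YoungDiagram} (T : SemistandardYoungTableau μ) (v : ℕ) :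
    content T v = (μ.cells.filter fun c => T c.1 c.2 = v).card := by
  rw [content, Finsupp.finsetSum_apply, Finset.card_filter]
  exact Finset.sum_congr rfl fun c _ => Finsupp.single_apply

theorem coeff_schurFunction (μ : YoungDiagram) {d : ℕ →₀ ℕ} {N : ℕ} (hd : ∀ i, N ≤ i → d i = 0) :
    MvPowerSeries.coeff d (schurFunction K μ) =
      ((signedTableaux (fun _ => False) d N μ).ncard : K) := by
  change ((Nat.card {T : SemistandardYoungTableau μ // content T = d} : ℕ) : K) = _
  rw [← Nat.card_coe_set_eq]
  congr 1
  refine Nat.card_congr (Equiv.ofBijective (fun T => ⟨fun c => T.1 c.1 c.2, ?_⟩) ⟨?_, ?_⟩)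
  · obtain ⟨T, rfl⟩ := T
    refine ⟨fun c hc => T.zeros hc, fun c hc => ?_, ?_, ?_, fun v _ => (content_apply T v).symm⟩
    · by_contra hlt
      have h1 := hd _ (not_lt.1 hlt)
      rw [content_apply, Finset.card_eq_zero, Finset.filter_eq_empty_iff] at h1
      exact h1 hc rfl
    · rintro ⟨i, j⟩ _ ⟨i', j'⟩ hb h1 h2
      obtain rfl : i = i' := h1
      exact ⟨T.row_weak h2 hb, fun _ h => h⟩
    · rintro ⟨i, j⟩ _ ⟨i', j'⟩ hb h1 h2
      obtain rfl : j = j' := h1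
      have h3 := T.col_strict h2 hb
      exact ⟨h3.le, fun h => absurd h h3.ne⟩
  · intro T T' h
    refine Subtype.ext (SemistandardYoungTableau.ext fun i j => ?_)
    exact congrFun (congrArg Subtype.val h) (i, j)
  · rintro ⟨T, h0, hN, hrow, hcol, hcont⟩
    let S : SemistandardYoungTableau μ :=
      { entry := fun i j => T (i, j)
        row_weak' := fun {i j1 j2} h1 h2 =>
          (hrow (i, j1) (μ.up_left_mem le_rfl h1.le h2) (i, j2) h2 rfl h1).1
        col_strict' := fun {i1 i2 j} h1 h2 => by
          have h3 := hcol (i1, j) (μ.up_left_mem h1.le le_rfl h2) (i2, j) h2 rfl h1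
          exact h3.1.lt_of_ne h3.2
        zeros' := fun h => h0 _ h }
    have hS : content S = d := by
      ext v
      rw [content_apply]
      by_cases hv : v < N
      · exact hcont v hv
      · rw [hd v (not_lt.1 hv), Finset.card_eq_zero, Finset.filter_eq_empty_iff]
        intro c hc h
        have := hN c hc
        change T c = v at h
        omega
    exact ⟨⟨S, hS⟩, rfl⟩

end Tableaux

/-! ### Coefficients of hook Schur functions -/

section HookTableaux

variable {k l : ℕ}

/-- The position of a symbol in the alphabet `1 < ⋯ < k < 1' < ⋯ < ℓ'`, counted from `0`. -/
def symbolIndex (s : Alphabet k l) : ℕ := varEmbedding k l (ofLex s)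

theorem symbolIndex_inl (i : Fin k) : symbolIndex (toLex (Sum.inl i) : Alphabet k l) = i := by
  simp [symbolIndex, varEmbedding]

theorem symbolIndex_inr (j : Fin l) : symbolIndex (toLex (Sum.inr j) : Alphabet k l) = k + j := by
  simp [symbolIndex, varEmbedding]

theorem varEmbedding_lt (s : Fin k ⊕ Fin l) : varEmbedding k l s < k + l :=
  (finSumFinEquiv s).2

theorem exists_varEmbedding_eq {v : ℕ} (hv : v < k + l) : ∃ s, varEmbedding k l s = v :=
  ⟨finSumFinEquiv.symm ⟨v, hv⟩, by simp [varEmbedding]⟩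

theorem symbolIndex_injective : Function.Injective (symbolIndex (k := k) (l := l)) :=
  (varEmbedding k l).injective.comp ofLex.injective

theorem symbolIndex_strictMono : StrictMono (symbolIndex (k := k) (l := l)) := by
  intro s t hst
  rcases hs : ofLex s with i | i <;> rcases ht : ofLex t with j | j
  all_goals
    obtain rfl : s = toLex _ := congrArg toLex hs
    obtain rfl : t = toLex _ := congrArg toLex ht
    simp only [symbolIndex_inl, symbolIndex_inr]
  · have h : i < j := Sum.Lex.inl_lt_inl_iff.1 hst
    exact h
  · have := i.2
    omega
  · exact absurd hst Sum.Lex.not_inr_lt_inl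
  · have h : i < j := Sum.Lex.inr_lt_inr_iff.1 hst
    exact Nat.add_lt_add_left h k

theorem isPrimed_iff (s : Alphabet k l) : IsPrimed s ↔ k ≤ symbolIndex s := by
  rcases hs : ofLex s with i | i
  all_goals
    obtain rfl : s = toLex _ := congrArg toLex hs
    simp only [symbolIndex_inl, symbolIndex_inr, IsPrimed, ofLex_toLex]
  · simp
  · simp

/-- A filling by symbols as a function on all cells. -/
def indexFilling {μ : YoungDiagram} (T : μ.cells → Alphabet k l) (c : ℕ × ℕ) : ℕ :=
  if h : c ∈ μ.cells then symbolIndex (T ⟨c, h⟩) else 0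

theorem indexFilling_coe {μ : YoungDiagram} (T : μ.cells → Alphabet k l) (c : μ.cells) :
    indexFilling T c.1 = symbolIndex (T c) := dif_pos c.2

theorem indexFilling_injective {μ : YoungDiagram} :
    Function.Injective (indexFilling (k := k) (l := l) (μ := μ)) := fun T T' h => by
  funext c
  apply symbolIndex_injective
  rw [← indexFilling_coe, ← indexFilling_coe, h]

theorem sum_single_eq_iff {μ : YoungDiagram} (T : μ.cells → Alphabet k l)
    (e : Fin k ⊕ Fin l →₀ ℕ) : ∑ c, Finsupp.single (ofLex (T c)) 1 = e ↔
      ∀ v < k + l, (μ.cells.filter fun c => indexFilling T c = v).card =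
        Finsupp.embDomain (varEmbedding k l) e v := by
  have h : ∀ s, (∑ c, Finsupp.single (ofLex (T c)) 1 : Fin k ⊕ Fin l →₀ ℕ) s =
      (μ.cells.filter fun c => indexFilling T c = varEmbedding k l s).card := by
    intro s
    classical
    rw [Finsupp.finsetSum_apply, Finset.card_filter, ← Finset.sum_coe_sort μ.cells]
    refine Finset.sum_congr rfl fun c _ => ?_
    rw [Finsupp.single_apply, indexFilling_coe, symbolIndex]
    simp only [(varEmbedding k l).injective.eq_iff]
  constructor
  · intro he v hv
    obtain ⟨s, rfl⟩ := exists_varEmbedding_eq hv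
    rw [Finsupp.embDomain_apply_self, ← h, he]
  · intro hv
    ext s
    rw [h, hv _ (varEmbedding_lt s), Finsupp.embDomain_apply_self]

theorem indexFilling_mem_signedTableaux_iff {μ : YoungDiagram} (T : μ.cells → Alphabet k l)
    (d : ℕ → ℕ) : indexFilling T ∈ signedTableaux (fun v => k ≤ v) d (k + l) μ ↔
      IsHookTableau T ∧ ∀ v < k + l, (μ.cells.filter fun c => indexFilling T c = v).card = d v := by
  have hle : ∀ s t : Alphabet k l, symbolIndex s ≤ symbolIndex t ↔ s ≤ t :=
    fun s t => symbolIndex_strictMono.le_iff_le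
  constructor
  · rintro ⟨-, -, hrow, hcol, hd⟩
    have hrow' : ∀ a b : μ.cells, a.1.1 = b.1.1 → a.1.2 < b.1.2 →
        T a ≤ T b ∧ (T a = T b → ¬ IsPrimed (T a)) := fun a b h1 h2 => by
      have h3 := hrow a.1 a.2 b.1 b.2 h1 h2
      rw [indexFilling_coe, indexFilling_coe, hle, symbolIndex_injective.eq_iff] at h3
      simpa only [isPrimed_iff] using h3
    have hcol' : ∀ a b : μ.cells, a.1.2 = b.1.2 → a.1.1 < b.1.1 →
        T a ≤ T b ∧ (T a = T b → IsPrimed (T a)) := fun a b h1 h2 => by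
      have h3 := hcol a.1 a.2 b.1 b.2 h1 h2
      rw [indexFilling_coe, indexFilling_coe, hle, symbolIndex_injective.eq_iff] at h3
      simpa only [isPrimed_iff] using h3
    exact ⟨⟨fun a b h1 h2 => (hrow' a b h1 h2).1, fun a b h1 h2 => (hcol' a b h1 h2).1,
      fun a b h1 h2 => (hrow' a b h1 h2).2, fun a b h1 h2 => (hcol' a b h1 h2).2⟩, hd⟩
  · rintro ⟨hT, hd⟩
    refine ⟨fun c hc => dif_neg hc, fun c hc => ?_, fun a ha b hb h1 h2 => ?_,
      fun a ha b hb h1 h2 => ?_, hd⟩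
    · rw [indexFilling_coe T ⟨c, hc⟩]
      exact varEmbedding_lt _
    · rw [indexFilling_coe T ⟨a, ha⟩, indexFilling_coe T ⟨b, hb⟩, hle,
        symbolIndex_injective.eq_iff]
      beta_reduce
      rw [← isPrimed_iff]
      exact ⟨hT.row_weak ⟨a, ha⟩ ⟨b, hb⟩ h1 h2, hT.row_primed ⟨a, ha⟩ ⟨b, hb⟩ h1 h2⟩
    · rw [indexFilling_coe T ⟨a, ha⟩, indexFilling_coe T ⟨b, hb⟩, hle,
        symbolIndex_injective.eq_iff]
      beta_reduce
      rw [← isPrimed_iff]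
      exact ⟨hT.col_weak ⟨a, ha⟩ ⟨b, hb⟩ h1 h2, hT.col_unprimed ⟨a, ha⟩ ⟨b, hb⟩ h1 h2⟩

theorem exists_indexFilling_eq {μ : YoungDiagram} {p : ℕ → Prop} {d : ℕ → ℕ} {T : ℕ × ℕ → ℕ}
    (hT : T ∈ signedTableaux p d (k + l) μ) :
    ∃ S : μ.cells → Alphabet k l, indexFilling S = T := by
  choose S hS using fun c : μ.cells => exists_varEmbedding_eq (hT.2.1 c.1 c.2)
  refine ⟨fun c => toLex (S c), funext fun c => ?_⟩
  by_cases hc : c ∈ μ.cells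
  · rw [indexFilling_coe _ ⟨c, hc⟩]
    exact hS ⟨c, hc⟩
  · rw [indexFilling, dif_neg hc]
    exact (hT.1 c hc).symm

theorem coeff_hookSchur (K : Type*) [Field K] (μ : YoungDiagram) (e : Fin k ⊕ Fin l →₀ ℕ) :
    MvPolynomial.coeff e (hookSchur K k l μ) = ((signedTableaux (fun v => k ≤ v)
      (Finsupp.embDomain (varEmbedding k l) e) (k + l) μ).ncard : K) := by
  classical
  have hX : ∀ T : μ.cells → Alphabet k l, MvPolynomial.coeff e
      (∏ c : μ.cells, MvPolynomial.X (R := K) (ofLex (T c))) =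
      if ∑ c, Finsupp.single (ofLex (T c)) 1 = e then 1 else 0 := by
    intro T
    rw [← MvPolynomial.coeff_monomial, MvPolynomial.monomial_sum_one]
    rfl
  rw [hookSchur, MvPolynomial.coeff_sum, Finset.sum_congr rfl fun T _ => hX T, Finset.sum_boole,
    Finset.filter_filter, ← Set.ncard_coe_finset]
  congr 1
  rw [← Set.ncard_image_of_injective _ indexFilling_injective]
  congr 1
  ext T
  simp only [Finset.coe_filter, Finset.mem_univ, true_and, Set.mem_image, Set.mem_ofPred_eq,
    sum_single_eq_iff]
  constructor
  · rintro ⟨S, hS, rfl⟩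
    exact (indexFilling_mem_signedTableaux_iff S _).2 hS
  · intro hT
    obtain ⟨S, rfl⟩ := exists_indexFilling_eq hT
    exact ⟨S, (indexFilling_mem_signedTableaux_iff S _).1 hT, rfl⟩

end HookTableaux

/-! ### Doubly symmetric functions in terms of strip operators -/

section Characterization

variable {K : Type*} [Field K]

theorem coeff_sum_schurFunction (m : YoungDiagram →₀ K) {d : ℕ →₀ ℕ} {N : ℕ}
    (hd : ∀ i, N ≤ i → d i = 0) :
    MvPowerSeries.coeff d (m.sum fun μ a => a • schurFunction K μ) =
      wordOp K (fun _ => False) d N m ⊥ := by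
  rw [← finsupp_sum_mul_ncard, Finsupp.sum, map_sum]
  refine Finset.sum_congr rfl fun μ _ => ?_
  rw [map_smul, coeff_schurFunction μ hd, smul_eq_mul]

theorem coeff_specialize_sum (m : YoungDiagram →₀ K) (k l : ℕ) (e : Fin k ⊕ Fin l →₀ ℕ) :
    MvPowerSeries.coeff e (specialize K k l (m.sum fun μ a => a • schurFunction K μ)) =
      wordOp K (fun _ => False) (Finsupp.embDomain (varEmbedding k l) e) (k + l) m ⊥ := by
  rw [specialize, MvPowerSeries.coeff_killCompl, coeff_sum_schurFunction]
  intro i hi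
  refine Finsupp.embDomain_of_notMem_range _ _ _ ?_
  rintro ⟨s, rfl⟩
  have := varEmbedding_lt s
  omega

theorem coeff_sum_hookSchur (m : YoungDiagram →₀ K) (k l : ℕ) (e : Fin k ⊕ Fin l →₀ ℕ) :
    MvPolynomial.coeff e (m.sum fun μ a => a • hookSchur K k l μ) =
      wordOp K (fun v => k ≤ v) (Finsupp.embDomain (varEmbedding k l) e) (k + l) m ⊥ := by
  rw [← finsupp_sum_mul_ncard, Finsupp.sum, MvPolynomial.coeff_sum]
  refine Finset.sum_congr rfl fun μ _ => ?_
  rw [MvPolynomial.coeff_smul, coeff_hookSchur, smul_eq_mul]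

theorem stripOp_isStrip_of_not {q : Prop} (hq : ¬ q) (r : ℕ) :
    stripOp K (IsStrip q) r = hOp K r := by
  have : IsStrip q = IsHorizontalStrip := by
    funext μ κ
    simp [IsStrip, hq]
  rw [this, hOp]

theorem stripOp_isStrip_of_pos {q : Prop} (hq : q) (r : ℕ) :
    stripOp K (IsStrip q) r = eOp K r := by
  have : IsStrip q = IsVerticalStrip := by
    funext μ κ
    simp [IsStrip, hq]
  rw [this, eOp]

theorem wordOp_false (d : ℕ → ℕ) (N : ℕ) :
    wordOp K (fun _ => False) d N = (((List.range N).map d).map (hOp K)).prod := by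
  rw [wordOp, List.map_map]
  exact congrArg (fun f => ((List.range N).map f).prod)
    (funext fun i => stripOp_isStrip_of_not id (d i))

/-- For the tableaux with `k` unprimed symbols below `l` primed ones, the vertical strips of the primed
symbols are removed first. -/
theorem wordOp_add (k l : ℕ) (d : ℕ → ℕ) :
    wordOp K (fun v => k ≤ v) d (k + l) = wordOp K (fun _ => False) d k *
      (((List.range l).map fun j => d (k + j)).map (eOp K)).prod := by
  have h : wordOp K (fun v => k ≤ v) d (k + l) = wordOp K (fun v => k ≤ v) d k *
      (((List.range l).map fun j => d (k + j)).map (eOp K)).prod := by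
    rw [wordOp, List.range_add, List.map_append, List.prod_append, List.map_map, List.map_map]
    congr 2
    exact List.map_congr_left fun j _ => stripOp_isStrip_of_pos (Nat.le_add_right k j) _
  rw [h, wordOp_congr (p' := fun _ => False) (fun i hi => by simp [hi]) fun _ _ => rfl]

theorem wordOp_false_add (k l : ℕ) (d : ℕ → ℕ) :
    wordOp K (fun _ => False) d (k + l) = wordOp K (fun _ => False) d k *
      (((List.range l).map fun j => d (k + j)).map (hOp K)).prod := by
  simp only [wordOp_false, List.range_add, List.map_append, List.prod_append, List.map_map]
  rfl

theorem eOp_mul_hOp_comm (r s : ℕ) : eOp K r * hOp K s = hOp K s * eOp K r := by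
  rw [← toEnd_coeff_hSeries, ← toEnd_coeff_eSeries, ← map_mul, mul_comm, map_mul]

theorem prod_hOp_apply_eq_prod_eOp_apply {g : YoungDiagram → K}
    (hg : ∀ r, hOp K r g = eOp K r g) (s : List ℕ) :
    (s.map (hOp K)).prod g = (s.map (eOp K)).prod g := by
  induction s with
  | nil => rfl
  | cons r s ih =>
    have hcomm : hOp K r * (s.map (eOp K)).prod = (s.map (eOp K)).prod * hOp K r := by
      refine (Commute.list_prod_right _ _ fun a ha => ?_).eq
      obtain ⟨t, -, rfl⟩ := List.mem_map.1 ha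
      exact (eOp_mul_hOp_comm t r).symm
    have hcomm' : eOp K r * (s.map (eOp K)).prod = (s.map (eOp K)).prod * eOp K r := by
      refine (Commute.list_prod_right _ _ fun a ha => ?_).eq
      obtain ⟨t, -, rfl⟩ := List.mem_map.1 ha
      change eOp K r * eOp K t = eOp K t * eOp K r
      rw [← toEnd_coeff_eSeries, ← toEnd_coeff_eSeries, ← map_mul, mul_comm, map_mul]
    rw [List.map_cons, List.prod_cons, List.map_cons, List.prod_cons, Module.End.mul_apply, ih,
      ← Module.End.mul_apply, hcomm, hcomm', Module.End.mul_apply, Module.End.mul_apply, hg]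

/-- The functions `∑ m_μ S_μ` and `∑ m_μ HS_μ` agree in all numbers of variables if and only if
removing horizontal strips from `m` has the same effect as removing vertical strips: one primed
variable suffices for one direction, and for the other one the operators commute. -/
theorem specialize_eq_hookSchur_iff (m : YoungDiagram →₀ K) :
    (∀ k l : ℕ, specialize K k l (m.sum fun μ a => a • schurFunction K μ) =
      ((m.sum (fun μ a => a • hookSchur K k l μ) : MvPolynomial (Fin k ⊕ Fin l) K) :
        MvPowerSeries (Fin k ⊕ Fin l) K)) ↔ ∀ r, hOp K r m = eOp K r m := by
  constructor
  · intro H r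
    refine sub_eq_zero.1 (eq_zero_of_prod_hOp_apply_bot fun s => ?_)
    -- The content with multiplicities `s` for the unprimed symbols and `r` for one primed symbol.
    let d : ℕ → ℕ := fun i => if i = s.length then r else s.getD i 0
    let e : Fin s.length ⊕ Fin 1 →₀ ℕ :=
      Finsupp.equivFunOnFinite.symm fun x => d (varEmbedding s.length 1 x)
    have he : ∀ i < s.length + 1, Finsupp.embDomain (varEmbedding s.length 1) e i = d i := by
      intro i hi
      obtain ⟨x, rfl⟩ := exists_varEmbedding_eq hi
      rw [Finsupp.embDomain_apply_self]
      rfl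
    have h1 := congrArg (MvPowerSeries.coeff e) (H s.length 1)
    rw [coeff_specialize_sum, MvPolynomial.coeff_coe, coeff_sum_hookSchur,
      wordOp_congr (fun _ _ => Iff.rfl) he,
      wordOp_congr (p := fun v => s.length ≤ v) (fun _ _ => Iff.rfl) he, wordOp_false_add,
      wordOp_add, wordOp_false] at h1
    have h2 : (List.range s.length).map d = s := by
      refine List.ext_getElem (by simp) fun i h3 h4 => ?_
      rw [List.getElem_map, List.getElem_range]
      simp [d, h4.ne, h4]
    have h3 : d (s.length + 0) = r := by simp [d]
    rw [h2] at h1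
    simp only [List.range_one, List.map_cons, List.map_nil, List.prod_cons, List.prod_nil, mul_one,
      h3, Module.End.mul_apply] at h1
    rw [map_sub, Pi.sub_apply, h1, sub_self]
  · intro hm k l
    ext e
    rw [coeff_specialize_sum, MvPolynomial.coeff_coe, coeff_sum_hookSchur, wordOp_false_add,
      wordOp_add, Module.End.mul_apply, Module.End.mul_apply, prod_hOp_apply_eq_prod_eOp_apply hm]

theorem degree_eq_sum_range {d : ℕ →₀ ℕ} {N : ℕ} (hd : ∀ i, N ≤ i → d i = 0) :
    d.degree = ∑ i ∈ Finset.range N, d i := by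
  refine Finset.sum_subset (fun i hi => ?_) fun i _ hi => Finsupp.notMem_support_iff.1 hi
  by_contra h
  rw [Finset.mem_range, not_lt] at h
  exact (Finsupp.mem_support_iff.1 hi) (hd i h)

/-- Schur functions are linearly independent, in each degree separately: a coefficient `m ν` is
determined by the homogeneous component of `∑ m_μ S_μ` of degree `|ν|`. -/
theorem apply_eq_zero_of_coeff_eq_zero (m : YoungDiagram →₀ K) {n : ℕ}
    (H : ∀ d : ℕ →₀ ℕ, d.degree = n →
      MvPowerSeries.coeff d (m.sum fun μ a => a • schurFunction K μ) = 0)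
    {ν : YoungDiagram} (hν : ν.card = n) : m ν = 0 := by
  classical
  -- The component of degree `n` of `m`.
  let g : YoungDiagram → K := fun μ => if μ.card = n then m μ else 0
  have hg : g = 0 := by
    refine eq_zero_of_prod_hOp_apply_bot fun s => ?_
    let d : ℕ →₀ ℕ := Finsupp.onFinset (Finset.range s.length) (fun i => s.getD i 0) (by
      intro i hi
      by_contra h
      rw [Finset.mem_range, not_lt] at h
      exact hi (List.getD_eq_default _ _ h))
    have h2 : (List.range s.length).map d = s := by
      refine List.ext_getElem (by simp) fun i h3 h4 => ?_
      rw [List.getElem_map, List.getElem_range]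
      simp [d, h4]
    have h3 : ∀ i, s.length ≤ i → d i = 0 := fun i hi => List.getD_eq_default _ _ hi
    have h4 := degree_eq_sum_range h3
    have h5 : wordOp K (fun _ => False) d s.length g ⊥ = 0 := by
      rw [← sum_ncard_signedTableaux_mul, ← h4]
      by_cases hn : d.degree = n
      · rw [← H d hn, coeff_sum_schurFunction m h3, ← sum_ncard_signedTableaux_mul, ← h4]
        refine Finset.sum_congr rfl fun μ hμ => ?_
        have : g μ = m μ := if_pos ((mem_diagrams.1 hμ).trans hn)
        rw [this]
      · refine Finset.sum_eq_zero fun μ hμ => ?_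
        have : g μ = 0 := if_neg (by rw [mem_diagrams.1 hμ]; exact hn)
        rw [this, mul_zero]
    rwa [wordOp_false, h2] at h5
  have h6 : g ν = m ν := if_pos hν
  rw [← h6, hg, Pi.zero_apply]

theorem isHomogeneous_sum_schurFunction {m : YoungDiagram →₀ K} {n : ℕ}
    (hm : ∀ μ, μ.card ≠ n → m μ = 0) :
    (m.sum fun μ a => a • schurFunction K μ).IsHomogeneous n := by
  intro d hd
  obtain ⟨N, hN⟩ : ∃ N, ∀ i, N ≤ i → d i = 0 := by
    refine ⟨d.support.sup id + 1, fun i hi => Finsupp.notMem_support_iff.1 fun h => ?_⟩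
    have : i ≤ d.support.sup id := Finset.le_sup (f := id) h
    omega
  rw [coeff_sum_schurFunction m hN, ← sum_ncard_signedTableaux_mul] at hd
  obtain ⟨μ, hμ, hne⟩ := Finset.exists_ne_zero_of_sum_ne_zero hd
  have h1 : μ.card = n := by
    by_contra h
    rw [hm μ h, mul_zero] at hne
    exact hne rfl
  have h2 : d.degree = n := by rw [degree_eq_sum_range hN, ← mem_diagrams.1 hμ, h1]
  rwa [Finsupp.degree_eq_weight_one] at h2

theorem exists_finsupp_eq {n : ℕ} {g : YoungDiagram → K} (hg : ∀ μ, μ.card ≠ n → g μ = 0) :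
    ∃ m : YoungDiagram →₀ K, ⇑m = g :=
  ⟨Finsupp.onFinset (diagrams n) g fun μ hμ => mem_diagrams.2 (by
    by_contra h
    exact hμ (hg μ h)), rfl⟩

variable (K) in
/-- The power series `∑ g μ • S_μ`, summed over the diagrams with `n` cells. -/
def toSymmetricFunction (n : ℕ) : (YoungDiagram → K) →ₗ[K] MvPowerSeries ℕ K :=
  ∑ μ ∈ diagrams n, (LinearMap.proj μ).smulRight (schurFunction K μ)

theorem toSymmetricFunction_coe {n : ℕ} {m : YoungDiagram →₀ K}
    (hm : ∀ μ, μ.card ≠ n → m μ = 0) :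
    toSymmetricFunction K n m = m.sum fun μ a => a • schurFunction K μ := by
  rw [toSymmetricFunction, LinearMap.sum_apply, Finsupp.sum_of_support_subset m (s := diagrams n)]
  · rfl
  · intro μ hμ
    rw [mem_diagrams]
    by_contra h
    exact Finsupp.mem_support_iff.1 hμ (hm μ h)
  · simp

theorem map_stripSymmetric (n : ℕ) :
    (stripSymmetric K n).map (toSymmetricFunction K n) = doublySymmetricOfDegree K n := by
  ext f
  rw [Submodule.mem_map]
  constructor
  · rintro ⟨g, hg, rfl⟩
    obtain ⟨m, rfl⟩ := exists_finsupp_eq hg.1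
    rw [toSymmetricFunction_coe hg.1]
    exact ⟨⟨m, rfl, (specialize_eq_hookSchur_iff m).2 hg.2⟩, isHomogeneous_sum_schurFunction hg.1⟩
  · rintro ⟨⟨m, rfl, hm⟩, hhom⟩
    have hdeg : ∀ μ, μ.card ≠ n → m μ = 0 := fun μ hμ =>
      apply_eq_zero_of_coeff_eq_zero m (n := μ.card) (fun d hd =>
        MvPowerSeries.IsHomogeneous.coeff_eq_zero hhom (hd.trans_ne hμ)) rfl
    exact ⟨m, ⟨hdeg, (specialize_eq_hookSchur_iff m).1 hm⟩, toSymmetricFunction_coe hdeg⟩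

theorem toSymmetricFunction_domRestrict_injective (n : ℕ) :
    Function.Injective ((toSymmetricFunction K n).domRestrict (stripSymmetric K n)) := by
  rw [← LinearMap.ker_eq_bot, LinearMap.ker_eq_bot']
  rintro ⟨g, hg⟩ h
  obtain ⟨m, rfl⟩ := exists_finsupp_eq hg.1
  rw [LinearMap.domRestrict_apply, toSymmetricFunction_coe hg.1] at h
  refine Subtype.ext (funext fun μ => ?_)
  exact apply_eq_zero_of_coeff_eq_zero m (fun d _ => by rw [h, map_zero]) rfl

variable (K) in
/-- The doubly symmetric functions of degree `n`, in the power sum coordinates. -/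
theorem nonempty_linearEquiv [CharZero K] (n : ℕ) :
    Nonempty (doublySymmetricOfDegree K n ≃ₗ[K] (Nat.Partition.odds n → K)) := by
  rw [← map_stripSymmetric, ← LinearMap.range_domRestrict]
  exact ⟨(LinearEquiv.ofInjective _ (toSymmetricFunction_domRestrict_injective n)).symm.trans
    (LinearEquiv.ofBijective _ (oddCoord_bijective n))⟩

end Characterization

end DoublySymmetric

end

theorem corollary3p11 (K : Type*) [Field K] [CharZero K] :
    Multipliable (fun k : ℕ => ((1 - PowerSeries.X ^ (2 * k + 1) : ℚ⟦X⟧))⁻¹) ∧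
    Multipliable (fun k : ℕ => (1 + PowerSeries.X ^ (k + 1) : ℚ⟦X⟧)) ∧
    ∏' k : ℕ, ((1 - PowerSeries.X ^ (2 * k + 1) : ℚ⟦X⟧))⁻¹ =
      ∏' k : ℕ, (1 + PowerSeries.X ^ (k + 1) : ℚ⟦X⟧) ∧
    ∀ n : ℕ,
      Module.Finite K (DoublySymmetric.doublySymmetricOfDegree K n) ∧
      Module.finrank K (DoublySymmetric.doublySymmetricOfDegree K n) =
        (Nat.Partition.odds n).card ∧
      (Module.finrank K (DoublySymmetric.doublySymmetricOfDegree K n) : ℚ) =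
        PowerSeries.coeff n (∏' k : ℕ, ((1 - PowerSeries.X ^ (2 * k + 1) : ℚ⟦X⟧))⁻¹) := by
  have h1 := DoublySymmetric.hasProd_inv_one_sub_X_pow_odd
  have h2 := DoublySymmetric.hasProd_one_add_X_pow
  refine ⟨h1.multipliable, h2.multipliable, ?_, fun n => ?_⟩
  · rw [h1.tprod_eq, h2.tprod_eq]
    simp only [Nat.Partition.card_odds_eq_card_distincts]
  · obtain ⟨L⟩ := DoublySymmetric.nonempty_linearEquiv K n
    have h3 : Module.finrank K (DoublySymmetric.doublySymmetricOfDegree K n) =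
        (Nat.Partition.odds n).card := by
      rw [L.finrank_eq, Module.finrank_fintype_fun_eq_card, Fintype.card_coe]
    exact ⟨Module.Finite.equiv L.symm, h3, by rw [h1.tprod_eq, h3, PowerSeries.coeff_mk]⟩
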